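/- Let $d\ge 2$ and $m>0$. On $\mathbb{R}^d$ let $x\cdot y=x^0y^0-\sum_{i=1}^{d-1}x^iy^i$, $W_0=\{x\in\mathbb{R}^d: x^1>|x^0|\}$ and $W_0'=-W_0$. Let $\omega(\mathbf p)=\sqrt{\mathbf p^2+m^2}$, $d\mu(p)=\omega(\mathbf p)^{-1}\delta(p^0-\omega(\mathbf p))\,dp$ and $\mathscr H_1=L^2(\mathbb{R}^d,d\mu)$. Let $\mathscr H=\bigoplus_{n\ge 0}\mathscr H_n$ be the antisymmetric Fock space over $\mathscr H_1$, where $\mathscr H_n$ is the space of antisymmetric functions in $L^2(d\mu(p_1)\cdots d\mu(p_n))$, and let $\mathcal D\subset\mathscr H$ be the subspace of vectors of finite particle number. For $f\in\mathscr S(\mathbb{R}^d)$ put $f^{\pm}(p)=\int dx\,f(x)e^{\pm ip\cdot x}$. A deformation function is a continuous function $R:\mathbb{R}\to\mathbb{C}$ such that (i) $R(a)^{-1}=\overline{R(a)}$ for all $a$; (ii) the Fourier transform $\widetilde R(t)=\int R(a)e^{-2\pi i at}\,da$, in the sense of tempered distributions, has support in $[0,\infty)$, so that $R$ extends to an analytic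 function on the upper half plane; (iii) this extension is continuous on the closed upper half plane. If $R$ is a deformation function, so is $-R$. For a deformation function $R$, a real $d\times d$ matrix $Q$ and $\varphi\in\mathscr H_1$, the deformed creation and annihilation operators $a^*_{R,Q}(\varphi)$ and $a_{R,Q}(\varphi)=a^*_{R,Q}(\varphi)^*$ act on $\mathcal D$ by $$(a^*_{R,Q}(\varphi)\Psi)_n(p_1,\dots,p_n)=\frac1{\sqrt n}\sum_{k=1}^n(-1)^{k+1}\varphi(p_k)\prod_{j\ne k}\overline{R(Qp_k\cdot p_j)}\;\Psi_{n-1}(p_1,\dots,\widehat{p_k},\dots,p_n),$$ $$(a_{R,Q}(\varphi)\Psi)_n(p_1,\dots,p_n)=\sqrt{n+1}\int d\mu(p)\,\overline{\varphi(p)}\prod_{j=1}^nR(Qp\cdot p_j)\;\Psi_{n+1}(p,p_1,\dots,p_n),$$ where $(a^*_{R,Q}(\varphi)\Psi)_0=0$. The deformed field is $\phi_{R,Q}(f)=a^*_{R,Q}(f^+)+a_{R,Q}(\overline{f^-})$; it maps $\mathcal D$ into $\mathcal D$. Let $R$ be a deformation function and let $Q$ be a real $d\times d$ matrix which is antisymmetric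 with respect to the Minkowski product, i.e. $Qx\cdot y=-x\cdot Qy$, and satisfies - $\Lambda Q\Lambda^{-1}=Q$ for $\Lambda\in\mathcal L_+^{\uparrow}$ with $\Lambda W_0=W_0$ and for $\Lambda\in\mathcal L_+^{\downarrow}$ with $\Lambda W_0=W_0'$, - $\Lambda Q\Lambda^{-1}=-Q$ for $\Lambda\in\mathcal L_+^{\downarrow}$ with $\Lambda W_0=W_0$ and for $\Lambda\in\mathcal L_+^{\uparrow}$ with $\Lambda W_0=W_0'$, where $\mathcal L_+^{\uparrow}$ and $\mathcal L_+^{\downarrow}$ are the sets of Lorentz transformations of determinant $1$ that preserve, respectively reverse, the time orientation. Let $\kappa=Q_{01}$ be the entry of $Q$ in the time row and the column of $x^1$. If $\kappa\ge 0$, then for all $f,g\in\mathscr S(\mathbb{R}^d)$ with $\operatorname{supp}f\subset W_0$ and $\operatorname{supp}g\subset W_0'$, $$[\phi_{R,Q}(f),\phi_{-R,-Q}(g)]\Psi=0\qquad\text{for all }\Psi\in\mathcal D.$$ -/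

import Mathlib

open MeasureTheory
open scoped SchwartzMap FourierTransform ENNReal ComplexConjugate Matrix

noncomputable section

namespace DeformedFermion

/-! ### Minkowski space of dimension `k + 2`, wedges, Lorentz transformations -/

/-- Minkowski space `ℝ^d` with `d = k + 2 ≥ 2`; coordinate `0` is time. -/
abbrev Spacetime (k : ℕ) := Fin (k + 2) → ℝ

/-- The Minkowski product `x · y = x⁰ y⁰ - 𝐱 𝐲`. -/
def mink {k : ℕ} (x y : Spacetime k) : ℝ :=
  x 0 * y 0 - ∑ i : Fin (k + 1), x i.succ * y i.succ

/-- The right wedge `W₀`. -/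
def rightWedge (k : ℕ) : Set (Spacetime k) := {x | |x 0| < x 1}

/-- The opposite wedge `W₀' = -W₀`. -/
def leftWedge (k : ℕ) : Set (Spacetime k) := {x | -x ∈ rightWedge k}

/-- Proper Lorentz transformations (`𝓛₊`). -/
def IsProperLorentz {k : ℕ} (Λ : Matrix (Fin (k + 2)) (Fin (k + 2)) ℝ) : Prop :=
  (∀ x y : Spacetime k, mink (Λ *ᵥ x) (Λ *ᵥ y) = mink x y) ∧ Λ.det = 1

/-- `𝓛₊^↑`: proper and time-orientation preserving. -/
def IsProperOrthochronous {k : ℕ} (Λ : Matrix (Fin (k + 2)) (Fin (k + 2)) ℝ) : Prop :=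
  IsProperLorentz Λ ∧ 0 < Λ 0 0

/-- `𝓛₊^↓`: proper and time-orientation reversing. -/
def IsProperAntichronous {k : ℕ} (Λ : Matrix (Fin (k + 2)) (Fin (k + 2)) ℝ) : Prop :=
  IsProperLorentz Λ ∧ Λ 0 0 < 0

/-- The admissible matrices `Q`. -/
structure IsAdmissible {k : ℕ} (Q : Matrix (Fin (k + 2)) (Fin (k + 2)) ℝ) : Prop where
  antisymm : ∀ x y : Spacetime k, mink (Q *ᵥ x) y = -mink x (Q *ᵥ y)
  up_right : ∀ Λ, IsProperOrthochronous Λ →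
    (fun x => Λ *ᵥ x) '' rightWedge k = rightWedge k → Λ * Q * Λ⁻¹ = Q
  down_right : ∀ Λ, IsProperAntichronous Λ →
    (fun x => Λ *ᵥ x) '' rightWedge k = rightWedge k → Λ * Q * Λ⁻¹ = -Q
  up_left : ∀ Λ, IsProperOrthochronous Λ →
    (fun x => Λ *ᵥ x) '' rightWedge k = leftWedge k → Λ * Q * Λ⁻¹ = -Q
  down_left : ∀ Λ, IsProperAntichronous Λ →
    (fun x => Λ *ᵥ x) '' rightWedge k = leftWedge k → Λ * Q * Λ⁻¹ = Q

/-! ### Deformation functions -/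

theorem memLp_top_of_unimodular {R : ℝ → ℂ} (hc : Continuous R)
    (hu : ∀ a, conj (R a) * R a = 1) : MemLp R ∞ volume := by
  refine memLp_top_of_bound hc.aestronglyMeasurable 1 (Filter.Eventually.of_forall fun a => ?_)
  have h := congrArg norm (hu a)
  rw [norm_mul, RCLike.norm_conj, norm_one] at h
  nlinarith [norm_nonneg (R a)]

/-- The tempered distribution `h ↦ ∫ R(a) h(a) da` of a continuous unimodular function. -/
def toDistribution (R : ℝ → ℂ) (hc : Continuous R) (hu : ∀ a, conj (R a) * R a = 1) :
    𝓢'(ℝ, ℂ) :=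
  Lp.toTemperedDistribution ((memLp_top_of_unimodular hc hu).toLp R)

/-- Deformation functions. The Fourier transform is `R̃(t) = ∫ R(a) exp(-2πi a t) da`, in the sense
of tempered distributions; its support lies in the closed half line `[0, ∞)`, i.e. it vanishes on
test functions supported in `(-∞, 0)`. -/
structure DeformationFunction where
  toFun : ℝ → ℂ
  continuous : Continuous toFun
  unimodular : ∀ a, conj (toFun a) * toFun a = 1
  fourier_support :
    Distribution.IsVanishingOn
      (𝓕 (toDistribution toFun continuous unimodular) : 𝓢'(ℝ, ℂ)) (Set.Iio (0 : ℝ))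
  extension : ∃ F : ℂ → ℂ, DifferentiableOn ℂ F {z | 0 < z.im} ∧
    ContinuousOn F {z | 0 ≤ z.im} ∧ ∀ a : ℝ, F a = toFun a

instance : CoeFun DeformationFunction fun _ => ℝ → ℂ := ⟨DeformationFunction.toFun⟩

theorem toDistribution_neg (R : ℝ → ℂ) (hc : Continuous R) (hu : ∀ a, conj (R a) * R a = 1)
    (hc' : Continuous (-R)) (hu' : ∀ a, conj ((-R) a) * (-R) a = 1) :
    toDistribution (-R) hc' hu' = -toDistribution R hc hu := by
  ext h
  have h1 := (memLp_top_of_unimodular hc hu).coeFn_toLp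
  have h2 := (memLp_top_of_unimodular hc' hu').coeFn_toLp
  simp only [toDistribution]
  rw [Lp.toTemperedDistribution_apply]
  change _ = -(Lp.toTemperedDistribution _ h)
  rw [Lp.toTemperedDistribution_apply, ← integral_neg]
  refine integral_congr_ae ?_
  filter_upwards [h1, h2] with a ha hb
  rw [ha, hb]
  simp

/-- If `R` is a deformation function, so is `-R`. -/
instance : Neg DeformationFunction where
  neg R :=
    { toFun := fun a => -R a
      continuous := R.continuous.neg
      unimodular := fun a => by simpa using R.unimodular a
      fourier_support := by
        intro u hu
        have h := R.fourier_support u hu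
        have e := toDistribution_neg R R.continuous R.unimodular R.continuous.neg
          (fun a => by simpa using R.unimodular a)
        refine (congrArg (fun T : 𝓢'(ℝ, ℂ) => T (𝓕 u)) e).trans ?_
        change -(toDistribution _ _ _ (𝓕 u)) = 0
        rw [neg_eq_zero]
        exact h
      extension := by
        obtain ⟨F, h1, h2, h3⟩ := R.extension
        exact ⟨fun z => -F z, h1.neg, h2.neg, fun a => by simp [h3 a]⟩ }

theorem DeformationFunction.norm_eq_one (R : DeformationFunction) (a : ℝ) : ‖R a‖ = 1 := by
  have h := congrArg norm (R.unimodular a)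
  rw [norm_mul, RCLike.norm_conj, norm_one] at h
  nlinarith [norm_nonneg (R a)]

/-! ### The one-particle space -/

/-- The energy `ω(𝐩) = √(𝐩² + m²)`. -/
def energy {k : ℕ} (m : ℝ) (p : Fin (k + 1) → ℝ) : ℝ := Real.sqrt (∑ i, p i ^ 2 + m ^ 2)

/-- The point `(ω(𝐩), 𝐩)` of the mass shell `H_m^+`. -/
def onShell {k : ℕ} (m : ℝ) (p : Fin (k + 1) → ℝ) : Spacetime k := Fin.cons (energy m p) p

/-- The measure `dμ(p) = ω(𝐩)⁻¹ δ(p⁰ - ω(𝐩)) dp` on `ℝ^d`. -/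
def shellMeasure (k : ℕ) (m : ℝ) : Measure (Spacetime k) :=
  ((volume : Measure (Fin (k + 1) → ℝ)).withDensity
    fun p => ENNReal.ofReal (energy m p)⁻¹).map (onShell m)

theorem continuous_energy {k : ℕ} (m : ℝ) :
    Continuous (energy m : (Fin (k + 1) → ℝ) → ℝ) := by
  unfold energy
  fun_prop

theorem continuous_onShell {k : ℕ} (m : ℝ) :
    Continuous (onShell m : (Fin (k + 1) → ℝ) → Spacetime k) := by
  refine continuous_pi fun i => ?_
  refine Fin.cases ?_ (fun j => ?_) i
  · simpa [onShell] using continuous_energy m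
  · simpa [onShell] using continuous_apply j

instance {k : ℕ} (m : ℝ) : SigmaFinite (shellMeasure k m) := by
  set ν := (volume : Measure (Fin (k + 1) → ℝ)).withDensity
    fun p => ENNReal.ofReal (energy m p)⁻¹ with hν
  have hS : SigmaFinite ν := by
    rw [hν]
    exact SigmaFinite.withDensity_of_ne_top (Filter.Eventually.of_forall fun _ => ENNReal.ofReal_ne_top)
  have ht : Measurable (Fin.tail : Spacetime k → Fin (k + 1) → ℝ) :=
    measurable_pi_lambda _ fun i => measurable_pi_apply i.succ
  refine ⟨⟨{
    set := fun n => Fin.tail ⁻¹' spanningSets ν n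
    set_mem := fun _ => trivial
    finite := fun n => ?_
    spanning := ?_ }⟩⟩
  · change (Measure.map (onShell m) ν) _ < ∞
    rw [Measure.map_apply (continuous_onShell m).measurable
      (ht (measurableSet_spanningSets ν n))]
    have : onShell m ⁻¹' (Fin.tail ⁻¹' spanningSets ν n) = spanningSets ν n := by
      ext p
      simp [onShell, Fin.tail_cons]
    rw [this]
    exact measure_spanningSets_lt_top ν n
  · rw [← Set.preimage_iUnion, iUnion_spanningSets, Set.preimage_univ]

/-- The one-particle space `ℋ₁ = L²(ℝ^d, dμ)`. -/
abbrev OneParticle (k : ℕ) (m : ℝ) := Lp ℂ 2 (shellMeasure k m)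

/-- The Fourier transform `f̃(p) = ∫ f(x) exp(i p·x) dx` with the Minkowski product. -/
def minkFourier {k : ℕ} (f : 𝓢(Spacetime k, ℂ)) (p : Spacetime k) : ℂ :=
  ∫ x, f x * Complex.exp (Complex.I * (mink p x : ℝ))

theorem minkFourier_eq {k : ℕ} (f : 𝓢(Spacetime k, ℂ)) :
    ∃ g : 𝓢(EuclideanSpace ℝ (Fin (k + 2)), ℂ), ∀ p : Spacetime k,
      minkFourier f p =
        g (WithLp.toLp 2 fun i => (2 * Real.pi)⁻¹ * Fin.cases (-p 0) (fun j => p j.succ) i) := by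
  refine ⟨𝓕 (SchwartzMap.compCLMOfContinuousLinearEquiv ℂ
    (EuclideanSpace.equiv (Fin (k + 2)) ℝ) f), fun p => ?_⟩
  rw [SchwartzMap.fourier_coe, Real.fourier_eq', minkFourier,
    ← (PiLp.volume_preserving_ofLp (Fin (k + 2))).integral_comp
      (MeasurableEquiv.toLp 2 _).symm.measurableEmbedding]
  refine integral_congr_ae (Filter.Eventually.of_forall fun x => ?_)
  simp only [smul_eq_mul]
  rw [mul_comm]
  congr 1
  · congr 1
    have : inner ℝ x (WithLp.toLp 2 fun i : Fin (k + 2) =>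
        (2 * Real.pi)⁻¹ * (Fin.cases (-p 0) (fun j => p j.succ) i : ℝ))
        = -(2 * Real.pi)⁻¹ * mink p x.ofLp := by
      simp only [PiLp.inner_apply, mink, Fin.sum_univ_succ (n := k + 1), Fin.cases_zero,
        Fin.cases_succ, RCLike.inner_apply, conj_trivial]
      rw [mul_sub, Finset.mul_sum, sub_eq_add_neg, ← Finset.sum_neg_distrib]
      congr 1
      · ring
      · exact Finset.sum_congr rfl fun i _ => by ring
    rw [this]
    have hpi : (Real.pi : ℂ) ≠ 0 := by exact_mod_cast Real.pi_ne_zero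
    push_cast
    field_simp

theorem memLp_minkFourier {k : ℕ} {m : ℝ} (hm : 0 < m) (f : 𝓢(Spacetime k, ℂ)) (s : ℝ)
    (hs : s = 1 ∨ s = -1) :
    MemLp (fun p => minkFourier f (s • p)) 2 (shellMeasure k m) := by
  obtain ⟨g, hg⟩ := minkFourier_eq f
  have hcont : Continuous fun p : Spacetime k => minkFourier f (s • p) := by
    simp only [hg]
    refine g.continuous.comp ((PiLp.continuous_toLp 2 _).comp (continuous_pi fun i => ?_))
    refine Fin.cases ?_ (fun j => ?_) i
    · simp only [Fin.cases_zero]; fun_prop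
    · simp only [Fin.cases_succ]; fun_prop
  obtain ⟨C, hC⟩ : ∃ C : ℝ, ∀ y, (1 + ‖y‖) ^ (k + 2) * ‖g y‖ ≤ C :=
    ⟨_, fun y => by
      simpa using SchwartzMap.one_add_le_sup_seminorm_apply (𝕜 := ℂ) (m := (k + 2, 0))
        le_rfl le_rfl g y⟩
  have hbound : ∀ p : Fin (k + 1) → ℝ, ‖minkFourier f (s • onShell m p)‖ ≤
      C * (2 * Real.pi) ^ (k + 2) * ((1 + ‖p‖) ^ (k + 2))⁻¹ := by
    intro p
    rw [hg]
    set y : EuclideanSpace ℝ (Fin (k + 2)) := WithLp.toLp 2 fun i =>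
      (2 * Real.pi)⁻¹ * Fin.cases (-(s • onShell m p) 0) (fun j => (s • onShell m p) j.succ) i
      with hy
    have hpi := Real.pi_gt_three
    have hny : ‖p‖ ≤ 2 * Real.pi * ‖y‖ := by
      refine (pi_norm_le_iff_of_nonneg (by positivity)).2 fun j => ?_
      have h1 := PiLp.norm_apply_le y j.succ
      have h2 : y j.succ = (2 * Real.pi)⁻¹ * (s * p j) := by
        simp [hy, onShell]
      have h3 : ‖y j.succ‖ = (2 * Real.pi)⁻¹ * ‖p j‖ := by
        rw [h2, norm_mul, norm_mul, Real.norm_of_nonneg (by positivity : 0 ≤ (2 * Real.pi)⁻¹)]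
        rcases hs with rfl | rfl <;> simp
      rw [h3] at h1
      calc ‖p j‖ = 2 * Real.pi * ((2 * Real.pi)⁻¹ * ‖p j‖) := by field_simp
        _ ≤ _ := by gcongr
    have h1 : (1 + ‖p‖) ^ (k + 2) ≤ (2 * Real.pi) ^ (k + 2) * (1 + ‖y‖) ^ (k + 2) := by
      rw [← mul_pow]
      gcongr
      linarith
    have hp0 : 0 < (1 + ‖p‖) ^ (k + 2) := by positivity
    rw [← div_eq_mul_inv, le_div_iff₀ hp0]
    calc ‖g y‖ * (1 + ‖p‖) ^ (k + 2)
        ≤ ‖g y‖ * ((2 * Real.pi) ^ (k + 2) * (1 + ‖y‖) ^ (k + 2)) := by gcongr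
      _ = ((1 + ‖y‖) ^ (k + 2) * ‖g y‖) * (2 * Real.pi) ^ (k + 2) := by ring
      _ ≤ C * (2 * Real.pi) ^ (k + 2) := by gcongr; exact hC y
  rw [shellMeasure, memLp_map_measure_iff hcont.aestronglyMeasurable
    (continuous_onShell m).aemeasurable]
  have hle : (volume : Measure (Fin (k + 1) → ℝ)).withDensity
      (fun p => ENNReal.ofReal (energy m p)⁻¹) ≤ ENNReal.ofReal m⁻¹ • volume := by
    rw [← withDensity_const]
    refine withDensity_mono (Filter.Eventually.of_forall fun p => ENNReal.ofReal_le_ofReal ?_)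
    refine inv_anti₀ hm (Real.le_sqrt_of_sq_le ?_)
    have : 0 ≤ ∑ i, p i ^ 2 := Finset.sum_nonneg fun i _ => sq_nonneg _
    linarith
  refine MemLp.of_measure_le_smul ENNReal.ofReal_ne_top hle ?_
  have hdom : MemLp (fun p : Fin (k + 1) → ℝ =>
      C * (2 * Real.pi) ^ (k + 2) * ((1 + ‖p‖) ^ (k + 2))⁻¹) 2 volume := by
    refine MemLp.const_mul ?_ _
    have hc : Continuous fun p : Fin (k + 1) → ℝ => ((1 + ‖p‖) ^ (k + 2))⁻¹ :=
      Continuous.inv₀ (by fun_prop) fun p => by positivity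
    rw [memLp_two_iff_integrable_sq hc.aestronglyMeasurable]
    have := integrable_one_add_norm (E := Fin (k + 1) → ℝ) (μ := volume)
      (r := ((2 * (k + 2) : ℕ) : ℝ)) (by
        rw [Module.finrank_fin_fun]
        exact_mod_cast (by omega : k + 1 < 2 * (k + 2)))
    refine this.congr (Filter.Eventually.of_forall fun p => ?_)
    simp only
    rw [Real.rpow_neg (by positivity), Real.rpow_natCast, inv_pow, ← pow_mul, mul_comm 2]
  exact hdom.mono' (hcont.comp (continuous_onShell m)).aestronglyMeasurable
    (Filter.Eventually.of_forall hbound)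

/-- `f⁺ = f̃|_{H_m^+}` as an element of `ℋ₁`. -/
def plusVector {k : ℕ} {m : ℝ} (hm : 0 < m) (f : 𝓢(Spacetime k, ℂ)) : OneParticle k m :=
  MemLp.toLp (fun p => minkFourier f p)
    (by simpa using memLp_minkFourier hm f 1 (Or.inl rfl))

/-- `conj f⁻`, where `f⁻(p) = f̃(-p)` on `H_m^+`, as an element of `ℋ₁`. -/
def conjMinusVector {k : ℕ} {m : ℝ} (hm : 0 < m) (f : 𝓢(Spacetime k, ℂ)) : OneParticle k m :=
  MemLp.toLp (fun p => conj (minkFourier f (-p)))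
    (by
      have h := (memLp_minkFourier hm f (-1) (Or.inr rfl)).star
      simp only [neg_smul, one_smul] at h
      exact h)

/-! ### Fock space -/

/-- The product measure `dμ(p₁) ⋯ dμ(pₙ)`. -/
abbrev shellMeasureN (k : ℕ) (m : ℝ) (n : ℕ) : Measure (Fin n → Spacetime k) :=
  Measure.pi fun _ => shellMeasure k m

theorem measurePreserving_perm {k : ℕ} (m : ℝ) {n : ℕ} (σ : Equiv.Perm (Fin n)) :
    MeasurePreserving (fun p : Fin n → Spacetime k => p ∘ σ)
      (shellMeasureN k m n) (shellMeasureN k m n) := by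
  have h := measurePreserving_piCongrLeft (α := fun _ : Fin n => Spacetime k)
    (fun _ => shellMeasure k m) σ.symm
  convert h using 1
  funext p i
  rw [MeasurableEquiv.coe_piCongrLeft]
  simpa using (Equiv.piCongrLeft_apply_apply (fun _ : Fin n => Spacetime k) σ.symm p (σ i)).symm

/-- The `n`-particle space `ℋₙ`: antisymmetric elements of `L²(dμ(p₁) ⋯ dμ(pₙ))`. -/
def nParticle (k : ℕ) (m : ℝ) (n : ℕ) : Submodule ℂ (Lp ℂ 2 (shellMeasureN k m n)) where
  carrier := {Ψ | ∀ σ : Equiv.Perm (Fin n),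
    (fun p => Ψ (p ∘ σ)) =ᵐ[shellMeasureN k m n]
      fun p => ((Equiv.Perm.sign σ : ℤ) : ℂ) * Ψ p}
  add_mem' := by
    intro Ψ Φ hΨ hΦ σ
    have h := Lp.coeFn_add Ψ Φ
    filter_upwards [hΨ σ, hΦ σ, h,
      (measurePreserving_perm m σ).quasiMeasurePreserving.ae_eq_comp h] with p h1 h2 h3 h4
    simp only [Function.comp_apply, Pi.add_apply] at h3 h4 ⊢
    rw [h3, h4, h1, h2, mul_add]
  zero_mem' := by
    intro σ
    have h := Lp.coeFn_zero ℂ 2 (shellMeasureN k m n)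
    filter_upwards [h,
      (measurePreserving_perm m σ).quasiMeasurePreserving.ae_eq_comp h] with p h3 h4
    simp only [Function.comp_apply, Pi.zero_apply] at h3 h4 ⊢
    rw [h3, h4, mul_zero]
  smul_mem' := by
    intro c Ψ hΨ σ
    have h := Lp.coeFn_smul c Ψ
    filter_upwards [hΨ σ, h,
      (measurePreserving_perm m σ).quasiMeasurePreserving.ae_eq_comp h] with p h1 h3 h4
    simp only [Function.comp_apply, Pi.smul_apply, smul_eq_mul] at h3 h4 ⊢
    rw [h3, h4, h1, mul_left_comm]

/-- The antisymmetric Fock space `ℋ = ⊕ₙ ℋₙ` (Hilbert space direct sum). -/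
abbrev FockSpace (k : ℕ) (m : ℝ) := lp (fun n => nParticle k m n) 2

/-- The subspace `𝒟 ⊂ ℋ` of vectors of finite particle number. -/
def finiteParticle (k : ℕ) (m : ℝ) : Submodule ℂ (FockSpace k m) where
  carrier := {Ψ | ∃ N : ℕ, ∀ n, N ≤ n → Ψ n = 0}
  add_mem' := by
    rintro Ψ Φ ⟨N, hN⟩ ⟨M, hM⟩
    refine ⟨max N M, fun n hn => ?_⟩
    rw [lp.coeFn_add, Pi.add_apply, hN n (le_of_max_le_left hn), hM n (le_of_max_le_right hn),
      add_zero]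
  zero_mem' := ⟨0, fun n _ => by simp⟩
  smul_mem' := by
    rintro c Ψ ⟨N, hN⟩
    exact ⟨N, fun n hn => by rw [lp.coeFn_smul, Pi.smul_apply, hN n hn, smul_zero]⟩

/-! ### Deformed creation and annihilation operators -/

/-- The function `(p₁, …, pₙ) ↦ ∏ⱼ R(x · pⱼ)` by which `T_R(x)` multiplies on `ℋₙ`. -/
def multiplier {k : ℕ} (R : DeformationFunction) (x : Spacetime k) {n : ℕ}
    (p : Fin n → Spacetime k) : ℂ :=
  ∏ j, R (mink x (p j))

/-- The wave function of `a*_{R,Q}(φ) Ψ = ∫ dμ(p) φ(p) a*(p) T_R(Qp)^* Ψ` for `Ψ ∈ ℋₙ`: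
`(n+1)^{-1/2} ∑ⱼ (-1)^j φ(pⱼ) conj (∏_{l ≠ j} R(Q pⱼ · p_l)) Ψ(p₀, …, p̂ⱼ, …, pₙ)`. -/
def creationFun {k : ℕ} (R : DeformationFunction) (Q : Matrix (Fin (k + 2)) (Fin (k + 2)) ℝ)
    (φ : Spacetime k → ℂ) {n : ℕ} (Ψ : (Fin n → Spacetime k) → ℂ)
    (p : Fin (n + 1) → Spacetime k) : ℂ :=
  ((Real.sqrt (n + 1) : ℝ) : ℂ)⁻¹ * ∑ j : Fin (n + 1), (-1) ^ (j : ℕ) *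
    (φ (p j) * conj (multiplier R (Q *ᵥ p j) (j.removeNth p)) * Ψ (j.removeNth p))

/-- The wave function of `a_{R,Q}(φ) Ψ = ∫ dμ(p) conj φ(p) T_R(Qp) a(p) Ψ` for `Ψ ∈ ℋₙ₊₁`:
`(n+1)^{1/2} ∫ dμ(q) conj φ(q) ∏ⱼ R(Qq · pⱼ) Ψ(q, p₁, …, pₙ)`. -/
def annihilationFun {k : ℕ} (m : ℝ) (R : DeformationFunction)
    (Q : Matrix (Fin (k + 2)) (Fin (k + 2)) ℝ)
    (φ : Spacetime k → ℂ) {n : ℕ} (Ψ : (Fin (n + 1) → Spacetime k) → ℂ)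
    (p : Fin n → Spacetime k) : ℂ :=
  ((Real.sqrt (n + 1) : ℝ) : ℂ) *
    ∫ q, conj (φ q) * (multiplier R (Q *ᵥ q) p * Ψ (Fin.cons q p)) ∂(shellMeasure k m)

theorem norm_multiplier {k : ℕ} (R : DeformationFunction) (x : Spacetime k) {n : ℕ}
    (p : Fin n → Spacetime k) : ‖multiplier R x p‖ = 1 := by
  simp [multiplier, norm_prod, R.norm_eq_one]

theorem multiplier_perm {k : ℕ} (R : DeformationFunction) (x : Spacetime k) {n : ℕ}
    (p : Fin n → Spacetime k) (σ : Equiv.Perm (Fin n)) :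
    multiplier R x (p ∘ σ) = multiplier R x p :=
  Equiv.prod_comp σ fun j => R (mink x (p j))

theorem continuous_multiplier {k : ℕ} (R : DeformationFunction)
    (Q : Matrix (Fin (k + 2)) (Fin (k + 2)) ℝ) (n : ℕ) :
    Continuous fun z : Spacetime k × (Fin n → Spacetime k) => multiplier R (Q *ᵥ z.1) z.2 := by
  refine continuous_finsetProd _ fun j _ => R.continuous.comp ?_
  have h : ∀ i, Continuous fun z : Spacetime k × (Fin n → Spacetime k) => (Q *ᵥ z.1) i :=
    fun i => (continuous_apply i).comp (continuous_const.matrix_mulVec continuous_fst)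
  have h' : ∀ i, Continuous fun z : Spacetime k × (Fin n → Spacetime k) => z.2 j i :=
    fun i => by fun_prop
  unfold mink
  exact ((h 0).mul (h' 0)).sub (continuous_finsetSum _ fun i _ => (h i.succ).mul (h' i.succ))

/-- Splitting off the `j`-th momentum preserves the measure. -/
theorem measurePreserving_split {k : ℕ} (m : ℝ) {n : ℕ} (j : Fin (n + 1)) :
    MeasurePreserving (fun p : Fin (n + 1) → Spacetime k => (p j, j.removeNth p))
      (shellMeasureN k m (n + 1)) ((shellMeasure k m).prod (shellMeasureN k m n)) :=
  measurePreserving_piFinSuccAbove (fun _ : Fin (n + 1) => shellMeasure k m) j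

theorem measurePreserving_cons {k : ℕ} (m : ℝ) (n : ℕ) :
    MeasurePreserving (fun z : Spacetime k × (Fin n → Spacetime k) =>
        (Fin.cons z.1 z.2 : Fin (n + 1) → Spacetime k))
      ((shellMeasure k m).prod (shellMeasureN k m n)) (shellMeasureN k m (n + 1)) := by
  have h := (measurePreserving_piFinSuccAbove (fun _ : Fin (n + 1) => shellMeasure k m) 0).symm
  convert h using 1
  funext z
  exact (Fin.insertNth_zero' z.1 z.2).symm

theorem quasiMeasurePreserving_removeNth {k : ℕ} (m : ℝ) {n : ℕ} (j : Fin (n + 1)) :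
    Measure.QuasiMeasurePreserving (fun p : Fin (n + 1) → Spacetime k => j.removeNth p)
      (shellMeasureN k m (n + 1)) (shellMeasureN k m n) :=
  Measure.quasiMeasurePreserving_snd.comp (measurePreserving_split m j).quasiMeasurePreserving

theorem creationFun_congr {k : ℕ} {m : ℝ} (R : DeformationFunction)
    (Q : Matrix (Fin (k + 2)) (Fin (k + 2)) ℝ) (φ : Spacetime k → ℂ) {n : ℕ}
    {Ψ Φ : (Fin n → Spacetime k) → ℂ} (h : Ψ =ᵐ[shellMeasureN k m n] Φ) :
    creationFun R Q φ Ψ =ᵐ[shellMeasureN k m (n + 1)] creationFun R Q φ Φ := by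
  have hj : ∀ᵐ p ∂(shellMeasureN k m (n + 1)), ∀ j : Fin (n + 1),
      Ψ (j.removeNth p) = Φ (j.removeNth p) :=
    ae_all_iff.2 fun j => (quasiMeasurePreserving_removeNth m j).ae_eq_comp h
  filter_upwards [hj] with p hp
  simp only [creationFun, hp]

theorem memLp_tensor {k : ℕ} {m : ℝ} (R : DeformationFunction)
    (Q : Matrix (Fin (k + 2)) (Fin (k + 2)) ℝ) {φ : Spacetime k → ℂ}
    (hφ : MemLp φ 2 (shellMeasure k m)) {n : ℕ}
    {Ψ : (Fin n → Spacetime k) → ℂ} (hΨ : MemLp Ψ 2 (shellMeasureN k m n)) :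
    MemLp (fun z : Spacetime k × (Fin n → Spacetime k) =>
      φ z.1 * conj (multiplier R (Q *ᵥ z.1) z.2) * Ψ z.2) 2
      ((shellMeasure k m).prod (shellMeasureN k m n)) := by
  have hm : AEStronglyMeasurable (fun z : Spacetime k × (Fin n → Spacetime k) =>
      φ z.1 * conj (multiplier R (Q *ᵥ z.1) z.2) * Ψ z.2)
      ((shellMeasure k m).prod (shellMeasureN k m n)) :=
    (hφ.1.comp_fst.mul
      (Complex.continuous_conj.comp (continuous_multiplier R Q n)).aestronglyMeasurable).mul
      hΨ.1.comp_snd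
  rw [memLp_two_iff_integrable_sq_norm hm]
  refine (((memLp_two_iff_integrable_sq_norm hφ.1).1 hφ).mul_prod
    ((memLp_two_iff_integrable_sq_norm hΨ.1).1 hΨ)).congr
    (Filter.Eventually.of_forall fun z => ?_)
  simp [norm_multiplier, mul_pow]

theorem memLp_creationFun {k : ℕ} {m : ℝ} (R : DeformationFunction)
    (Q : Matrix (Fin (k + 2)) (Fin (k + 2)) ℝ) {φ : Spacetime k → ℂ}
    (hφ : MemLp φ 2 (shellMeasure k m)) {n : ℕ}
    {Ψ : (Fin n → Spacetime k) → ℂ} (hΨ : MemLp Ψ 2 (shellMeasureN k m n)) :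
    MemLp (creationFun R Q φ Ψ) 2 (shellMeasureN k m (n + 1)) := by
  have hj : ∀ j : Fin (n + 1), MemLp (fun p : Fin (n + 1) → Spacetime k => (-1) ^ (j : ℕ) *
      (φ (p j) * conj (multiplier R (Q *ᵥ p j) (j.removeNth p)) * Ψ (j.removeNth p))) 2
      (shellMeasureN k m (n + 1)) := fun j =>
    ((memLp_tensor R Q hφ hΨ).comp_measurePreserving
      (measurePreserving_split m j)).const_mul ((-1) ^ (j : ℕ))
  exact (memLp_finsetSum Finset.univ fun j _ => hj j).const_mul
    ((Real.sqrt (n + 1) : ℝ) : ℂ)⁻¹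

/-- A permutation of `n + 1` points induces one of `n` points after omission of a point. -/
theorem exists_perm_removeNth {n : ℕ} (σ : Equiv.Perm (Fin (n + 1))) (j : Fin (n + 1)) :
    ∃ τ : Equiv.Perm (Fin n), (∀ i, σ (j.succAbove i) = (σ j).succAbove (τ i)) ∧
      (-1 : ℂ) ^ (j : ℕ) * ((Equiv.Perm.sign τ : ℤ) : ℂ) =
        ((Equiv.Perm.sign σ : ℤ) : ℂ) * (-1) ^ ((σ j : Fin (n + 1)) : ℕ) := by
  set ρ : Equiv.Perm (Fin (n + 1)) := (σ j).cycleRange * σ * j.cycleRange⁻¹ with hρ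
  obtain ⟨⟨a, τ⟩, hτ⟩ := Equiv.Perm.decomposeFin.symm.surjective ρ
  have ha : a = 0 := by
    have h := Equiv.Perm.decomposeFin_symm_apply_zero a τ
    rw [hτ, hρ] at h
    simpa [Equiv.Perm.inv_def] using h.symm
  subst ha
  refine ⟨τ, fun i => ?_, ?_⟩
  · have h := Equiv.Perm.decomposeFin_symm_apply_succ τ 0 i
    rw [hτ, hρ] at h
    simp only [Equiv.Perm.inv_def, Equiv.Perm.mul_apply, Fin.cycleRange_symm_succ,
      Equiv.swap_self, Equiv.refl_apply] at h
    rw [← Fin.cycleRange_symm_succ (σ j), ← h, Equiv.symm_apply_apply]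
  · have h := Equiv.Perm.decomposeFin.symm_sign 0 τ
    rw [hτ, hρ] at h
    simp only [map_mul, map_inv, Fin.sign_cycleRange, if_true, one_mul] at h
    rw [← h]
    have e1 : ∀ i : ℕ, ((-1 : ℤˣ) ^ i)⁻¹ = (-1) ^ i := fun i => by simp [← inv_pow]
    rw [e1]
    push_cast
    have e2 : ∀ i : ℕ, (-1 : ℂ) ^ i * (-1) ^ i = 1 := fun i => by
      rw [← mul_pow]; simp
    linear_combination (((Equiv.Perm.sign σ : ℤ) : ℂ) * (-1) ^ ((σ j : Fin (n + 1)) : ℕ)) * e2 j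

theorem creationFun_antisymm {k : ℕ} {m : ℝ} (R : DeformationFunction)
    (Q : Matrix (Fin (k + 2)) (Fin (k + 2)) ℝ) (φ : Spacetime k → ℂ) {n : ℕ}
    {Ψ : (Fin n → Spacetime k) → ℂ}
    (h : ∀ σ : Equiv.Perm (Fin n), (fun p => Ψ (p ∘ σ)) =ᵐ[shellMeasureN k m n]
      fun p => ((Equiv.Perm.sign σ : ℤ) : ℂ) * Ψ p) (σ : Equiv.Perm (Fin (n + 1))) :
    (fun p => creationFun R Q φ Ψ (p ∘ σ)) =ᵐ[shellMeasureN k m (n + 1)]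
      fun p => ((Equiv.Perm.sign σ : ℤ) : ℂ) * creationFun R Q φ Ψ p := by
  have hj : ∀ᵐ p ∂(shellMeasureN k m (n + 1)), ∀ (j : Fin (n + 1)) (τ : Equiv.Perm (Fin n)),
      Ψ (j.removeNth p ∘ τ) = ((Equiv.Perm.sign τ : ℤ) : ℂ) * Ψ (j.removeNth p) :=
    ae_all_iff.2 fun j => ae_all_iff.2 fun τ =>
      (quasiMeasurePreserving_removeNth m j).ae_eq_comp (h τ)
  filter_upwards [hj] with p hp
  simp only [creationFun]
  rw [mul_left_comm]
  congr 1
  rw [Finset.mul_sum]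
  conv_rhs => rw [← Equiv.sum_comp σ]
  refine Finset.sum_congr rfl fun j _ => ?_
  obtain ⟨τ, hτ, hs⟩ := exists_perm_removeNth σ j
  have e : j.removeNth (p ∘ σ) = (σ j).removeNth p ∘ τ := by
    funext i
    simp [Fin.removeNth, hτ]
  rw [e, multiplier_perm, hp]
  simp only [Function.comp_apply]
  linear_combination (φ (p (σ j)) * conj (multiplier R (Q *ᵥ p (σ j)) ((σ j).removeNth p)) *
    Ψ ((σ j).removeNth p)) * hs

theorem memLp_split {k : ℕ} {m : ℝ} {n : ℕ} {Ψ : (Fin (n + 1) → Spacetime k) → ℂ}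
    (hΨ : MemLp Ψ 2 (shellMeasureN k m (n + 1))) :
    MemLp (fun z : Spacetime k × (Fin n → Spacetime k) => Ψ (Fin.cons z.1 z.2)) 2
      ((shellMeasure k m).prod (shellMeasureN k m n)) :=
  hΨ.comp_measurePreserving (measurePreserving_cons m n)

theorem ae_ae_cons {k : ℕ} {m : ℝ} {n : ℕ} {P : (Fin (n + 1) → Spacetime k) → Prop}
    (h : ∀ᵐ p ∂(shellMeasureN k m (n + 1)), P p) :
    ∀ᵐ p ∂(shellMeasureN k m n), ∀ᵐ q ∂(shellMeasure k m), P (Fin.cons q p) :=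
  Measure.ae_ae_of_ae_prod (Measure.measurePreserving_swap.quasiMeasurePreserving.ae
    ((measurePreserving_cons m n).quasiMeasurePreserving.ae h))

theorem annihilationFun_congr {k : ℕ} {m : ℝ} (R : DeformationFunction)
    (Q : Matrix (Fin (k + 2)) (Fin (k + 2)) ℝ) (φ : Spacetime k → ℂ) {n : ℕ}
    {Ψ Φ : (Fin (n + 1) → Spacetime k) → ℂ} (h : Ψ =ᵐ[shellMeasureN k m (n + 1)] Φ) :
    annihilationFun m R Q φ Ψ =ᵐ[shellMeasureN k m n] annihilationFun m R Q φ Φ := by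
  filter_upwards [ae_ae_cons h] with p hp
  simp only [annihilationFun]
  congr 1
  refine integral_congr_ae ?_
  filter_upwards [hp] with q hq
  rw [hq]

theorem annihilationFun_antisymm {k : ℕ} {m : ℝ} (R : DeformationFunction)
    (Q : Matrix (Fin (k + 2)) (Fin (k + 2)) ℝ) (φ : Spacetime k → ℂ) {n : ℕ}
    {Ψ : (Fin (n + 1) → Spacetime k) → ℂ}
    (h : ∀ σ : Equiv.Perm (Fin (n + 1)), (fun p => Ψ (p ∘ σ)) =ᵐ[shellMeasureN k m (n + 1)]
      fun p => ((Equiv.Perm.sign σ : ℤ) : ℂ) * Ψ p) (σ : Equiv.Perm (Fin n)) :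
    (fun p => annihilationFun m R Q φ Ψ (p ∘ σ)) =ᵐ[shellMeasureN k m n]
      fun p => ((Equiv.Perm.sign σ : ℤ) : ℂ) * annihilationFun m R Q φ Ψ p := by
  have hσ := ae_ae_cons (h (Equiv.Perm.decomposeFin.symm (0, σ)))
  filter_upwards [hσ] with p hp
  simp only [annihilationFun]
  rw [mul_left_comm, ← integral_const_mul ((Equiv.Perm.sign σ : ℤ) : ℂ)]
  congr 1
  refine integral_congr_ae ?_
  filter_upwards [hp] with q hq
  have e : (Fin.cons q p : Fin (n + 1) → Spacetime k) ∘ (Equiv.Perm.decomposeFin.symm (0, σ))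
      = Fin.cons q (p ∘ σ) := by
    funext i
    refine Fin.cases ?_ (fun i => ?_) i <;> simp
  rw [e, Equiv.Perm.decomposeFin.symm_sign, if_pos rfl, one_mul] at hq
  rw [multiplier_perm, hq]
  ring

/-- The integrand of the annihilation operator is square integrable in `q`, for almost all `p`. -/
theorem ae_memLp_cons {k : ℕ} {m : ℝ} {n : ℕ} {Ψ : (Fin (n + 1) → Spacetime k) → ℂ}
    (hΨ : MemLp Ψ 2 (shellMeasureN k m (n + 1))) :
    ∀ᵐ p ∂(shellMeasureN k m n),
      MemLp (fun q => Ψ (Fin.cons q p)) 2 (shellMeasure k m) := by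
  have h := memLp_split hΨ
  have h1 := (memLp_two_iff_integrable_sq_norm h.1).1 h
  have h2 := h.1.prod_swap.prodMk_left
  filter_upwards [h1.prod_left_ae, h2] with p hp hp'
  exact (memLp_two_iff_integrable_sq_norm hp').2 hp

theorem ae_integrable_cons {k : ℕ} {m : ℝ} (R : DeformationFunction)
    (Q : Matrix (Fin (k + 2)) (Fin (k + 2)) ℝ) {φ : Spacetime k → ℂ}
    (hφ : MemLp φ 2 (shellMeasure k m)) {n : ℕ} {Ψ : (Fin (n + 1) → Spacetime k) → ℂ}
    (hΨ : MemLp Ψ 2 (shellMeasureN k m (n + 1))) :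
    ∀ᵐ p ∂(shellMeasureN k m n),
      Integrable (fun q => conj (φ q) * (multiplier R (Q *ᵥ q) p * Ψ (Fin.cons q p)))
        (shellMeasure k m) := by
  filter_upwards [ae_memLp_cons hΨ] with p hp
  have hc : Continuous fun q : Spacetime k => multiplier R (Q *ᵥ q) p :=
    (continuous_multiplier R Q n).comp (Continuous.prodMk_left p)
  have h2 : MemLp (fun q => multiplier R (Q *ᵥ q) p * Ψ (Fin.cons q p)) 2 (shellMeasure k m) :=
    hp.congr_norm (hc.aestronglyMeasurable.mul hp.1)
      (Filter.Eventually.of_forall fun q => by simp [norm_multiplier])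
  exact MemLp.integrable_mul (p := 2) (q := 2) hφ.star h2

theorem memLp_annihilationFun {k : ℕ} {m : ℝ} (R : DeformationFunction)
    (Q : Matrix (Fin (k + 2)) (Fin (k + 2)) ℝ) {φ : Spacetime k → ℂ}
    (hφ : MemLp φ 2 (shellMeasure k m)) {n : ℕ}
    {Ψ : (Fin (n + 1) → Spacetime k) → ℂ} (hΨ : MemLp Ψ 2 (shellMeasureN k m (n + 1))) :
    MemLp (annihilationFun m R Q φ Ψ) 2 (shellMeasureN k m n) := by
  refine MemLp.const_mul ?_ _
  have hs := memLp_split hΨ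
  have hmeas : AEStronglyMeasurable (fun z : Spacetime k × (Fin n → Spacetime k) =>
      conj (φ z.1) * (multiplier R (Q *ᵥ z.1) z.2 * Ψ (Fin.cons z.1 z.2)))
      ((shellMeasure k m).prod (shellMeasureN k m n)) :=
    (hφ.star.1.comp_fst).mul ((continuous_multiplier R Q n).aestronglyMeasurable.mul hs.1)
  have hint : AEStronglyMeasurable (fun p : Fin n → Spacetime k =>
      ∫ q, conj (φ q) * (multiplier R (Q *ᵥ q) p * Ψ (Fin.cons q p)) ∂(shellMeasure k m))
      (shellMeasureN k m n) := hmeas.prod_swap.integral_prod_right'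
  have hsq := (memLp_two_iff_integrable_sq_norm hs.1).1 hs
  rw [memLp_two_iff_integrable_sq_norm hint]
  have hdom := (hsq.integral_prod_right).const_mul (∫ q, ‖φ q‖ ^ 2 ∂(shellMeasure k m))
  refine hdom.mono' (hint.norm.pow 2) ?_
  filter_upwards [ae_memLp_cons hΨ] with p hp
  have h1 : ‖∫ q, conj (φ q) * (multiplier R (Q *ᵥ q) p * Ψ (Fin.cons q p))
      ∂(shellMeasure k m)‖ ≤ ∫ q, ‖φ q‖ * ‖Ψ (Fin.cons q p)‖ ∂(shellMeasure k m) := by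
    refine (norm_integral_le_integral_norm _).trans (le_of_eq ?_)
    simp [norm_multiplier]
  have h2 := integral_mul_norm_le_Lp_mul_Lq (μ := shellMeasure k m) (f := φ)
    (g := fun q => Ψ (Fin.cons q p)) Real.HolderConjugate.two_two
    (by simpa using hφ) (by simpa using hp)
  have hA : 0 ≤ ∫ q, ‖φ q‖ ^ 2 ∂(shellMeasure k m) := integral_nonneg fun _ => by positivity
  have hB : 0 ≤ ∫ q, ‖Ψ (Fin.cons q p)‖ ^ 2 ∂(shellMeasure k m) :=
    integral_nonneg fun _ => by positivity
  have h3 := h1.trans h2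
  simp only [Real.rpow_ofNat] at h3
  rw [← Real.sqrt_eq_rpow, ← Real.sqrt_eq_rpow, ← Real.sqrt_mul hA] at h3
  rw [norm_pow, norm_norm]
  calc _ ≤ _ := pow_le_pow_left₀ (norm_nonneg _) h3 2
    _ = _ := Real.sq_sqrt (mul_nonneg hA hB)

/-- `creationFun` as a linear map on `L²` spaces. -/
def creationL2 {k : ℕ} {m : ℝ} (R : DeformationFunction)
    (Q : Matrix (Fin (k + 2)) (Fin (k + 2)) ℝ) (φ : OneParticle k m) (n : ℕ) :
    Lp ℂ 2 (shellMeasureN k m n) →ₗ[ℂ] Lp ℂ 2 (shellMeasureN k m (n + 1)) where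
  toFun Ψ := (memLp_creationFun R Q (Lp.memLp φ) (Lp.memLp Ψ)).toLp (creationFun R Q φ Ψ)
  map_add' Ψ Φ := by
    rw [← MemLp.toLp_add]
    refine MemLp.toLp_congr _ _ ((creationFun_congr R Q φ (Lp.coeFn_add Ψ Φ)).trans
      (Filter.Eventually.of_forall fun p => ?_))
    simp only [creationFun, Pi.add_apply, mul_add, Finset.sum_add_distrib]
  map_smul' c Ψ := by
    rw [RingHom.id_apply, ← MemLp.toLp_const_smul]
    refine MemLp.toLp_congr _ _ ((creationFun_congr R Q φ (Lp.coeFn_smul c Ψ)).trans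
      (Filter.Eventually.of_forall fun p => ?_))
    simp only [creationFun, Pi.smul_apply, smul_eq_mul, Finset.mul_sum]
    exact Finset.sum_congr rfl fun j _ => by ring

/-- `annihilationFun` as a linear map on `L²` spaces. -/
def annihilationL2 {k : ℕ} {m : ℝ} (R : DeformationFunction)
    (Q : Matrix (Fin (k + 2)) (Fin (k + 2)) ℝ) (φ : OneParticle k m) (n : ℕ) :
    Lp ℂ 2 (shellMeasureN k m (n + 1)) →ₗ[ℂ] Lp ℂ 2 (shellMeasureN k m n) where
  toFun Ψ := (memLp_annihilationFun R Q (Lp.memLp φ) (Lp.memLp Ψ)).toLp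
    (annihilationFun m R Q φ Ψ)
  map_add' Ψ Φ := by
    rw [← MemLp.toLp_add]
    refine MemLp.toLp_congr _ _ ((annihilationFun_congr R Q φ (Lp.coeFn_add Ψ Φ)).trans ?_)
    filter_upwards [ae_integrable_cons R Q (Lp.memLp φ) (Lp.memLp Ψ),
      ae_integrable_cons R Q (Lp.memLp φ) (Lp.memLp Φ)] with p h1 h2
    simp only [annihilationFun, Pi.add_apply, mul_add]
    rw [integral_add h1 h2, mul_add]
  map_smul' c Ψ := by
    rw [RingHom.id_apply, ← MemLp.toLp_const_smul]
    refine MemLp.toLp_congr _ _ ((annihilationFun_congr R Q φ (Lp.coeFn_smul c Ψ)).trans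
      (Filter.Eventually.of_forall fun p => ?_))
    simp only [annihilationFun, Pi.smul_apply, smul_eq_mul]
    rw [mul_left_comm, ← integral_const_mul c]
    congr 1
    refine integral_congr_ae (Filter.Eventually.of_forall fun q => ?_)
    simp only
    ring

/-- `a*_{R,Q}(φ) : ℋₙ → ℋₙ₊₁`. -/
def creation {k : ℕ} {m : ℝ} (R : DeformationFunction)
    (Q : Matrix (Fin (k + 2)) (Fin (k + 2)) ℝ) (φ : OneParticle k m) (n : ℕ) :
    nParticle k m n →ₗ[ℂ] nParticle k m (n + 1) :=
  (creationL2 R Q φ n).restrict (by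
    intro Ψ hΨ σ
    have h := (memLp_creationFun R Q (Lp.memLp φ) (Lp.memLp Ψ)).coeFn_toLp
    filter_upwards [h, (measurePreserving_perm m σ).quasiMeasurePreserving.ae_eq_comp h,
      creationFun_antisymm R Q φ hΨ σ] with p h1 h2 h3
    exact h2.trans (h3.trans (congrArg _ h1.symm)))

/-- `a_{R,Q}(φ) : ℋₙ₊₁ → ℋₙ`. -/
def annihilation {k : ℕ} {m : ℝ} (R : DeformationFunction)
    (Q : Matrix (Fin (k + 2)) (Fin (k + 2)) ℝ) (φ : OneParticle k m) (n : ℕ) :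
    nParticle k m (n + 1) →ₗ[ℂ] nParticle k m n :=
  (annihilationL2 R Q φ n).restrict (by
    intro Ψ hΨ σ
    have h := (memLp_annihilationFun R Q (Lp.memLp φ) (Lp.memLp Ψ)).coeFn_toLp
    filter_upwards [h, (measurePreserving_perm m σ).quasiMeasurePreserving.ae_eq_comp h,
      annihilationFun_antisymm R Q φ hΨ σ] with p h1 h2 h3
    exact h2.trans (h3.trans (congrArg _ h1.symm)))

/-- `a_{R,Q}(φ)` is the adjoint of `a*_{R,Q}(φ)`. -/
theorem inner_creation {k : ℕ} {m : ℝ} (R : DeformationFunction)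
    (Q : Matrix (Fin (k + 2)) (Fin (k + 2)) ℝ) (φ : OneParticle k m) (n : ℕ)
    (Φ : nParticle k m n) (Ψ : nParticle k m (n + 1)) :
    inner ℂ (creation R Q φ n Φ) Ψ = inner ℂ Φ (annihilation R Q φ n Ψ) := by
  set G : Spacetime k × (Fin n → Spacetime k) → ℂ := fun z =>
    conj (φ z.1 * conj (multiplier R (Q *ᵥ z.1) z.2) * Φ.1 z.2) * Ψ.1 (Fin.cons z.1 z.2) with hG
  have hs := memLp_split (Lp.memLp Ψ.1)
  have hGi : Integrable G ((shellMeasure k m).prod (shellMeasureN k m n)) :=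
    MemLp.integrable_mul (p := 2) (q := 2)
      (memLp_tensor R Q (Lp.memLp φ) (Lp.memLp Φ.1)).star hs
  have hcomp : ∀ j : Fin (n + 1),
      Integrable (fun p : Fin (n + 1) → Spacetime k => G (p j, j.removeNth p))
        (shellMeasureN k m (n + 1)) := fun j =>
    ((measurePreserving_split m j).integrable_comp hGi.1).2 hGi
  have hint : ∀ j : Fin (n + 1), ∫ p, G (p j, j.removeNth p) ∂(shellMeasureN k m (n + 1)) =
      ∫ z, G z ∂((shellMeasure k m).prod (shellMeasureN k m n)) := fun j =>
    (measurePreserving_split m j).integral_comp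
      (MeasurableEquiv.piFinSuccAbove (fun _ : Fin (n + 1) => Spacetime k) j).measurableEmbedding G
  have hL : inner ℂ (creation R Q φ n Φ) Ψ = ((Real.sqrt (n + 1) : ℝ) : ℂ) *
      ∫ z, G z ∂((shellMeasure k m).prod (shellMeasureN k m n)) := by
    have h1 : inner ℂ (creation R Q φ n Φ) Ψ =
        ∫ p, ((Real.sqrt (n + 1) : ℝ) : ℂ)⁻¹ * ∑ j : Fin (n + 1), G (p j, j.removeNth p)
          ∂(shellMeasureN k m (n + 1)) := by
      rw [Submodule.coe_inner, L2.inner_def]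
      refine integral_congr_ae ?_
      have hc := (memLp_creationFun R Q (Lp.memLp φ) (Lp.memLp Φ.1)).coeFn_toLp
      have ha : ∀ᵐ p ∂(shellMeasureN k m (n + 1)), ∀ σ : Equiv.Perm (Fin (n + 1)),
          Ψ.1 (p ∘ σ) = ((Equiv.Perm.sign σ : ℤ) : ℂ) * Ψ.1 p := ae_all_iff.2 Ψ.2
      filter_upwards [hc, ha] with p hp hpa
      have hp' : (creation R Q φ n Φ : Lp ℂ 2 (shellMeasureN k m (n + 1))) p =
        creationFun R Q φ Φ.1 p := hp
      rw [RCLike.inner_apply, hp', creationFun, map_mul, map_inv₀, Complex.conj_ofReal, map_sum,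
        mul_left_comm, Finset.mul_sum]
      congr 1
      refine Finset.sum_congr rfl fun j _ => ?_
      have hj := hpa j.cycleRange.symm
      rw [Equiv.Perm.sign_symm, Fin.sign_cycleRange,
        ← Fin.cons_removeNth_eq_comp_cycleRange_symm] at hj
      simp only [hG]
      rw [hj]
      simp only [map_mul, map_pow, map_neg, map_one]
      push_cast
      ring
    rw [h1, integral_const_mul, integral_finsetSum _ fun j _ => hcomp j]
    simp only [hint, Finset.sum_const, Finset.card_univ, Fintype.card_fin, nsmul_eq_mul]
    rw [← mul_assoc]
    congr 1
    have hpos : (0 : ℝ) < n + 1 := by positivity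
    have hne : ((Real.sqrt (n + 1) : ℝ) : ℂ) ≠ 0 := by
      exact_mod_cast (Real.sqrt_pos.2 hpos).ne'
    rw [inv_mul_eq_iff_eq_mul₀ hne, ← Complex.ofReal_mul, Real.mul_self_sqrt hpos.le]
    push_cast
    rfl
  rw [hL, integral_prod_symm _ hGi, Submodule.coe_inner, L2.inner_def, ← integral_const_mul]
  refine integral_congr_ae ?_
  have hc := (memLp_annihilationFun R Q (Lp.memLp φ) (Lp.memLp Ψ.1)).coeFn_toLp
  filter_upwards [hc] with p hp
  have hp' : (annihilation R Q φ n Ψ : Lp ℂ 2 (shellMeasureN k m n)) p =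
    annihilationFun m R Q φ Ψ.1 p := hp
  rw [RCLike.inner_apply, hp', annihilationFun, mul_assoc, ← integral_mul_const]
  congr 1
  refine integral_congr_ae (Filter.Eventually.of_forall fun q => ?_)
  simp only [hG, map_mul, Complex.conj_conj]
  ring

/-! ### The deformed field -/

/-- The `n`-particle component of `φ_{R,Q}(f) Ψ = a*_{R,Q}(f⁺) Ψ + a_{R,Q}(conj f⁻) Ψ`. -/
def fieldComponent {k : ℕ} {m : ℝ} (hm : 0 < m) (R : DeformationFunction)
    (Q : Matrix (Fin (k + 2)) (Fin (k + 2)) ℝ) (f : 𝓢(Spacetime k, ℂ))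
    (Ψ : ∀ n, nParticle k m n) : ∀ n, nParticle k m n
  | 0 => annihilation R Q (conjMinusVector hm f) 0 (Ψ 1)
  | n + 1 => creation R Q (plusVector hm f) n (Ψ n) +
      annihilation R Q (conjMinusVector hm f) (n + 1) (Ψ (n + 2))

theorem fieldComponent_eq_zero {k : ℕ} {m : ℝ} (hm : 0 < m) (R : DeformationFunction)
    (Q : Matrix (Fin (k + 2)) (Fin (k + 2)) ℝ) (f : 𝓢(Spacetime k, ℂ))
    {Ψ : ∀ n, nParticle k m n} {N : ℕ} (hN : ∀ n, N ≤ n → Ψ n = 0) :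
    ∀ n, N + 1 ≤ n → fieldComponent hm R Q f Ψ n = 0
  | 0, h => by omega
  | n + 1, h => by
    simp only [fieldComponent]
    rw [hN n (by omega), hN (n + 2) (by omega), map_zero, map_zero, add_zero]

theorem fieldComponent_add {k : ℕ} {m : ℝ} (hm : 0 < m) (R : DeformationFunction)
    (Q : Matrix (Fin (k + 2)) (Fin (k + 2)) ℝ) (f : 𝓢(Spacetime k, ℂ))
    (Ψ Φ : ∀ n, nParticle k m n) : ∀ n, fieldComponent hm R Q f (Ψ + Φ) n =
      fieldComponent hm R Q f Ψ n + fieldComponent hm R Q f Φ n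
  | 0 => by simp only [fieldComponent, Pi.add_apply, map_add]
  | n + 1 => by
    simp only [fieldComponent, Pi.add_apply, map_add]
    exact add_add_add_comm _ _ _ _

theorem fieldComponent_smul {k : ℕ} {m : ℝ} (hm : 0 < m) (R : DeformationFunction)
    (Q : Matrix (Fin (k + 2)) (Fin (k + 2)) ℝ) (f : 𝓢(Spacetime k, ℂ)) (c : ℂ)
    (Ψ : ∀ n, nParticle k m n) : ∀ n, fieldComponent hm R Q f (c • Ψ) n =
      c • fieldComponent hm R Q f Ψ n
  | 0 => by simp only [fieldComponent, Pi.smul_apply, map_smul]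
  | n + 1 => by simp only [fieldComponent, Pi.smul_apply, map_smul, smul_add]

/-- The deformed field operator `φ_{R,Q}(f) = a*_{R,Q}(f⁺) + a_{R,Q}(conj f⁻)` on `𝒟`, for the
mass `m > 0`. -/
def field {k : ℕ} {m : ℝ} (hm : 0 < m) (R : DeformationFunction)
    (Q : Matrix (Fin (k + 2)) (Fin (k + 2)) ℝ) (f : 𝓢(Spacetime k, ℂ)) :
    finiteParticle k m →ₗ[ℂ] finiteParticle k m where
  toFun Ψ := ⟨⟨fieldComponent hm R Q f fun n => Ψ.1 n, by
    obtain ⟨N, hN⟩ := Ψ.2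
    refine (memℓp_zero ((Set.finite_lt_nat (N + 1)).subset fun n hn => ?_)).of_exponent_ge
      zero_le
    by_contra h
    exact hn (fieldComponent_eq_zero hm R Q f hN n (by simpa using h))⟩, by
    obtain ⟨N, hN⟩ := Ψ.2
    exact ⟨N + 1, fieldComponent_eq_zero hm R Q f hN⟩⟩
  map_add' Ψ Φ :=
    Subtype.ext (lp.ext (funext (fieldComponent_add hm R Q f (fun n => Ψ.1 n) fun n => Φ.1 n)))
  map_smul' c Ψ :=
    Subtype.ext (lp.ext (funext (fieldComponent_smul hm R Q f c fun n => Ψ.1 n)))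

end DeformedFermion

end

namespace DeformedFermion

variable {k : ℕ} {m : ℝ}

/-! Interchanging two momenta of an antisymmetric wave function costs a sign, and so does replacing
`R` by `-R`; the two signs cancel, and `Q` versus `-Q` makes the remaining phases match. Operators
of opposite deformations therefore obey commutation instead of anticommutation relations.
Annihilators commute (`annihilationFun_comm`), creators commute by taking adjoints, and the
commutator of an annihilator with a creator is multiplication by the scalar function `contraction`
(`annihilationFun_creationFun`). By `field_comm_of_contraction_eq` it remains to show, for almost
all momenta pⱼ, that ∫ f⁻ g⁺ ∏ R(Qq·pⱼ) conj R(-Qq·pⱼ) dμ(q) equals ∫ f⁺ g⁻ ∏ R(-Qq·pⱼ) conj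
R(Qq·pⱼ) dμ(q); the common factor (-1)ⁿ drops out.

In coordinates q = (M cosh θ, M sinh θ, v), with M the transverse mass, the measure dμ becomes dθ
dv, and the substitution θ ↦ θ + iπ, v ↦ -v turns q into -q. It thus exchanges f⁻ with f⁺, g⁺ with
g⁻, and Qq·pⱼ with -Qq·pⱼ, so the second integrand is the boundary value at Im θ = π of the first.
The shift of contour is legitimate because the integrand is bounded and analytic in the strip 0 < Im
θ < π: for f⁻ and g⁺ this follows from the supports in opposite wedges
(`isStripAnalytic_rapidityFourier`). For the deformation factors, the symmetry of `Q` leaves only κ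
= Q₀₁ in the dependence on θ, and κ ≥ 0 together with pⱼ⁰ > |pⱼ¹| gives Im(Qq·pⱼ) ≥ 0, so the
arguments stay in the closed upper half plane. These parts meet in `integral_shell_deformed_eq`.

The contour shift needs bounds on the half plane, whereas the extension of `R` is only given as
continuous. Bounded analytic approximants are therefore built from the support of R̃
(`DeformationFunction.exists_gaussian_approximation`): `R` is multiplied by the Fourier transform of
a bump supported on the negative axis, and the Fourier integral of the product is then summed with a
Gaussian factor. All approximants are bounded by 1 on the real line, so dominated convergence
carries the equality of contractions over to `R`. -/

/-! ### Exchange relations of the deformed operators -/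

/-- The pairs `(R, Q)` and `(-R, -Q)`, for `Q` antisymmetric with respect to the Minkowski
product. -/
structure OppositeDeformation (R R' : DeformationFunction)
    (Q Q' : Matrix (Fin (k + 2)) (Fin (k + 2)) ℝ) : Prop where
  exchange : ∀ x y : Spacetime k, R' (mink (Q' *ᵥ x) y) = -R (mink (Q *ᵥ y) x)

theorem mink_comm (x y : Spacetime k) : mink x y = mink y x := by
  simp [mink, mul_comm]

theorem mink_neg_left (x y : Spacetime k) : mink (-x) y = -mink x y := by
  simp [mink, neg_add_eq_sub]

theorem oppositeDeformation_neg (R : DeformationFunction)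
    {Q : Matrix (Fin (k + 2)) (Fin (k + 2)) ℝ}
    (hQ : ∀ x y : Spacetime k, mink (Q *ᵥ x) y = -mink x (Q *ᵥ y)) :
    OppositeDeformation R (-R) Q (-Q) where
  exchange x y := by
    rw [Matrix.neg_mulVec, mink_neg_left, hQ x y, neg_neg, mink_comm]
    rfl

theorem OppositeDeformation.symm {R R' : DeformationFunction}
    {Q Q' : Matrix (Fin (k + 2)) (Fin (k + 2)) ℝ} (h : OppositeDeformation R R' Q Q') :
    OppositeDeformation R' R Q' Q :=
  ⟨fun x y => by rw [h.exchange, neg_neg]⟩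

theorem measurePreserving_cons_cons (k : ℕ) (m : ℝ) (n : ℕ) :
    MeasurePreserving (fun z : (Spacetime k × Spacetime k) × (Fin n → Spacetime k) =>
        (Fin.cons z.1.1 (Fin.cons z.1.2 z.2 : Fin (n + 1) → Spacetime k) :
          Fin (n + 2) → Spacetime k))
      (((shellMeasure k m).prod (shellMeasure k m)).prod (shellMeasureN k m n))
      (shellMeasureN k m (n + 2)) :=
  (measurePreserving_cons m (n + 1)).comp
    (((MeasurePreserving.id (shellMeasure k m)).prod (measurePreserving_cons m n)).comp
      (measurePreserving_prodAssoc (shellMeasure k m) (shellMeasure k m) (shellMeasureN k m n)))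

theorem ae_ae_cons_cons {n : ℕ} {P : (Fin (n + 2) → Spacetime k) → Prop}
    (h : ∀ᵐ p ∂(shellMeasureN k m (n + 2)), P p) :
    ∀ᵐ p ∂(shellMeasureN k m n), ∀ᵐ z ∂((shellMeasure k m).prod (shellMeasure k m)),
      P (Fin.cons z.1 (Fin.cons z.2 p : Fin (n + 1) → Spacetime k)) :=
  Measure.ae_ae_of_ae_prod (Measure.measurePreserving_swap.quasiMeasurePreserving.ae
    ((measurePreserving_cons_cons k m n).quasiMeasurePreserving.ae h))

theorem ae_memLp_cons_cons {n : ℕ} {Ψ : (Fin (n + 2) → Spacetime k) → ℂ}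
    (hΨ : MemLp Ψ 2 (shellMeasureN k m (n + 2))) :
    ∀ᵐ p ∂(shellMeasureN k m n),
      MemLp (fun z : Spacetime k × Spacetime k =>
        Ψ (Fin.cons z.1 (Fin.cons z.2 p : Fin (n + 1) → Spacetime k))) 2
        ((shellMeasure k m).prod (shellMeasure k m)) := by
  have h := hΨ.comp_measurePreserving (measurePreserving_cons_cons k m n)
  have h1 := (memLp_two_iff_integrable_sq_norm h.1).1 h
  have h2 := h.1.prod_swap.prodMk_left
  filter_upwards [h1.prod_left_ae, h2] with p hp hp'
  exact (memLp_two_iff_integrable_sq_norm hp').2 hp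

theorem multiplier_cons (R : DeformationFunction) (x q : Spacetime k) {n : ℕ}
    (p : Fin n → Spacetime k) :
    multiplier R x (Fin.cons q p : Fin (n + 1) → Spacetime k) =
      R (mink x q) * multiplier R x p := by
  simp [multiplier, Fin.prod_univ_succ]

theorem multiplier_removeNth (R : DeformationFunction) (x : Spacetime k) {n : ℕ}
    (p : Fin (n + 1) → Spacetime k) (i : Fin (n + 1)) :
    multiplier R x p = R (mink x (p i)) * multiplier R x (i.removeNth p) := by
  simp only [multiplier, Fin.removeNth]
  exact Fin.prod_univ_succAbove (fun j => R (mink x (p j))) i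

theorem continuous_mink_mulVec (Q : Matrix (Fin (k + 2)) (Fin (k + 2)) ℝ) :
    Continuous fun z : Spacetime k × Spacetime k => mink (Q *ᵥ z.1) z.2 := by
  have h : ∀ i, Continuous fun z : Spacetime k × Spacetime k => (Q *ᵥ z.1) i :=
    fun i => (continuous_apply i).comp (continuous_const.matrix_mulVec continuous_fst)
  unfold mink
  exact ((h 0).mul (by fun_prop)).sub
    (continuous_finsetSum _ fun i _ => (h i.succ).mul (by fun_prop))

theorem annihilationFun_comm {R R' : DeformationFunction}
    {Q Q' : Matrix (Fin (k + 2)) (Fin (k + 2)) ℝ} (hR : OppositeDeformation R R' Q Q')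
    {φ χ : Spacetime k → ℂ} (hφ : MemLp φ 2 (shellMeasure k m))
    (hχ : MemLp χ 2 (shellMeasure k m)) {n : ℕ} {Ψ : (Fin (n + 2) → Spacetime k) → ℂ}
    (hΨ : MemLp Ψ 2 (shellMeasureN k m (n + 2)))
    (ha : ∀ σ : Equiv.Perm (Fin (n + 2)), (fun p => Ψ (p ∘ σ)) =ᵐ[shellMeasureN k m (n + 2)]
      fun p => ((Equiv.Perm.sign σ : ℤ) : ℂ) * Ψ p) :
    annihilationFun m R Q φ (annihilationFun m R' Q' χ Ψ) =ᵐ[shellMeasureN k m n]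
      annihilationFun m R' Q' χ (annihilationFun m R Q φ Ψ) := by
  -- For fixed generic p both sides are double integrals. In the pair z below, z.1 is the momentum
  -- removed by the operator with χ and z.2 the one removed by the operator with φ, whichever of the
  -- two acts first.
  filter_upwards [ae_memLp_cons_cons hΨ, ae_ae_cons_cons (ha (Equiv.swap 0 1))] with p hp hs
  set G : Spacetime k × Spacetime k → ℂ := fun z =>
    conj (φ z.2) * conj (χ z.1) * (multiplier R (Q *ᵥ z.2) p * multiplier R' (Q' *ᵥ z.1) p *
      R' (mink (Q' *ᵥ z.1) z.2)) *
      Ψ (Fin.cons z.1 (Fin.cons z.2 p : Fin (n + 1) → Spacetime k)) with hG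
  have hGi : Integrable G ((shellMeasure k m).prod (shellMeasure k m)) := by
    have h1 : MemLp (fun z : Spacetime k × Spacetime k => conj (φ z.2) * conj (χ z.1)) 2
        ((shellMeasure k m).prod (shellMeasure k m)) := by
      have hm : AEStronglyMeasurable
          (fun z : Spacetime k × Spacetime k => conj (φ z.2) * conj (χ z.1))
          ((shellMeasure k m).prod (shellMeasure k m)) :=
        hφ.star.1.comp_snd.mul hχ.star.1.comp_fst
      rw [memLp_two_iff_integrable_sq_norm hm]
      refine (((memLp_two_iff_integrable_sq_norm hχ.1).1 hχ).mul_prod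
        ((memLp_two_iff_integrable_sq_norm hφ.1).1 hφ)).congr
        (Filter.Eventually.of_forall fun z => ?_)
      simp only [norm_mul, RCLike.norm_conj, mul_pow]
      ring
    have hc : Continuous fun z : Spacetime k × Spacetime k =>
        multiplier R (Q *ᵥ z.2) p * multiplier R' (Q' *ᵥ z.1) p *
          R' (mink (Q' *ᵥ z.1) z.2) :=
      (((continuous_multiplier R Q n).comp (continuous_snd.prodMk continuous_const)).mul
        ((continuous_multiplier R' Q' n).comp (continuous_fst.prodMk continuous_const))).mul
        (R'.continuous.comp (continuous_mink_mulVec Q'))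
    -- The phases have modulus one, so they do not affect square integrability.
    have h2 := hp.congr_norm (hc.aestronglyMeasurable.mul hp.1)
      (Filter.Eventually.of_forall fun z => by
        simp [norm_multiplier, DeformationFunction.norm_eq_one])
    refine (MemLp.integrable_mul (p := 2) (q := 2) h1 h2).congr
      (Filter.Eventually.of_forall fun z => ?_)
    simp only [hG, Pi.mul_apply]
    ring
  have hL : annihilationFun m R Q φ (annihilationFun m R' Q' χ Ψ) p =
      ((Real.sqrt (n + 1) : ℝ) : ℂ) * (((Real.sqrt ((n + 1 : ℕ) + 1) : ℝ) : ℂ) *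
        ∫ z, G z ∂((shellMeasure k m).prod (shellMeasure k m))) := by
    rw [integral_prod_symm _ hGi]
    simp only [annihilationFun]
    rw [← integral_const_mul (((Real.sqrt ((n + 1 : ℕ) + 1) : ℝ) : ℂ))]
    congr 1
    refine integral_congr_ae (Filter.Eventually.of_forall fun q => ?_)
    simp only
    rw [mul_left_comm (multiplier R _ _), mul_left_comm, ← integral_const_mul,
      ← integral_const_mul]
    congr 1
    refine integral_congr_ae (Filter.Eventually.of_forall fun q' => ?_)
    simp only [hG, multiplier_cons]
    ring
  have hRt : annihilationFun m R' Q' χ (annihilationFun m R Q φ Ψ) p =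
      ((Real.sqrt (n + 1) : ℝ) : ℂ) * (((Real.sqrt ((n + 1 : ℕ) + 1) : ℝ) : ℂ) *
        ∫ z, G z ∂((shellMeasure k m).prod (shellMeasure k m))) := by
    -- First of the two signs: the transposition of the two removed momenta. The second one comes
    -- from `hR.exchange` at the end of this block.
    have hG' : G =ᵐ[(shellMeasure k m).prod (shellMeasure k m)]
        fun z => -(conj (φ z.2) * conj (χ z.1) *
          (multiplier R (Q *ᵥ z.2) p * multiplier R' (Q' *ᵥ z.1) p *
          R' (mink (Q' *ᵥ z.1) z.2)) *
          Ψ (Fin.cons z.2 (Fin.cons z.1 p : Fin (n + 1) → Spacetime k))) := by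
      filter_upwards [hs] with z hz
      have e : (Fin.cons z.1 (Fin.cons z.2 p : Fin (n + 1) → Spacetime k) :
          Fin (n + 2) → Spacetime k) ∘ (Equiv.swap 0 1) =
          Fin.cons z.2 (Fin.cons z.1 p : Fin (n + 1) → Spacetime k) := by
        funext i
        refine Fin.cases ?_ (fun i => Fin.cases ?_ (fun i => ?_) i) i
        · simp only [Function.comp_apply, Equiv.swap_apply_left, Fin.cons_zero]
          exact Fin.cons_succ (α := fun _ => Spacetime k) _ _ 0
        · simp only [Function.comp_apply, Fin.succ_zero_eq_one, Equiv.swap_apply_right,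
            Fin.cons_zero]
          exact (Fin.cons_succ (α := fun _ => Spacetime k) z.2
            (Fin.cons z.1 p : Fin (n + 1) → Spacetime k) 0).symm
        · have hi : i.succ.succ ≠ (1 : Fin (n + 2)) := by simp [Fin.ext_iff]
          rw [Function.comp_apply, Equiv.swap_apply_of_ne_of_ne (Fin.succ_ne_zero _) hi]
          simp
      rw [e, Equiv.Perm.sign_swap (by simp)] at hz
      simp only [hG]
      rw [hz]
      push_cast
      ring
    rw [integral_congr_ae hG', integral_prod _ (hGi.congr hG')]
    simp only [annihilationFun]
    rw [← integral_const_mul (((Real.sqrt ((n + 1 : ℕ) + 1) : ℝ) : ℂ))]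
    congr 1
    refine integral_congr_ae (Filter.Eventually.of_forall fun q => ?_)
    simp only
    rw [mul_left_comm (multiplier R' _ _), mul_left_comm, ← integral_const_mul,
      ← integral_const_mul]
    congr 1
    refine integral_congr_ae (Filter.Eventually.of_forall fun q' => ?_)
    simp only [multiplier_cons, hR.exchange]
    ring
  rw [hL, hRt]

/-- The function by which the contraction of `a_{R,Q}(φ)` with `a*_{R',Q'}(χ)` multiplies. -/
noncomputable def contraction (m : ℝ) (R R' : DeformationFunction)
    (Q Q' : Matrix (Fin (k + 2)) (Fin (k + 2)) ℝ) (φ χ : Spacetime k → ℂ) {n : ℕ}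
    (p : Fin n → Spacetime k) : ℂ :=
  ∫ q, conj (φ q) * χ q * (multiplier R (Q *ᵥ q) p * conj (multiplier R' (Q' *ᵥ q) p))
    ∂(shellMeasure k m)

/-- On the vacuum sector there is no term with the operators in the opposite order, so only the
contraction remains. -/
theorem annihilationFun_creationFun_zero (R R' : DeformationFunction)
    (Q Q' : Matrix (Fin (k + 2)) (Fin (k + 2)) ℝ) (φ χ : Spacetime k → ℂ)
    (Ψ : (Fin 0 → Spacetime k) → ℂ) (p : Fin 0 → Spacetime k) :
    annihilationFun m R Q φ (creationFun R' Q' χ Ψ) p =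
      contraction m R R' Q Q' φ χ p * Ψ p := by
  have h : ∀ q, creationFun R' Q' χ Ψ (Fin.cons q p) =
      χ q * conj (multiplier R' (Q' *ᵥ q) p) * Ψ p := by
    intro q
    have h0 : Fin.removeNth 0 (Fin.cons q p : Fin 1 → Spacetime k) = p :=
      Subsingleton.elim _ _
    rw [creationFun, Fin.sum_univ_succ]
    simp [h0]
  simp only [annihilationFun, contraction, h, ← integral_mul_const]
  simp only [CharP.cast_eq_zero, zero_add, Real.sqrt_one, Complex.ofReal_one, one_mul]
  refine integral_congr_ae (Filter.Eventually.of_forall fun q => ?_)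
  simp only
  ring

theorem removeNth_succ_cons {n : ℕ} (q : Spacetime k) (p : Fin (n + 1) → Spacetime k)
    (i : Fin (n + 1)) :
    i.succ.removeNth (Fin.cons q p : Fin (n + 2) → Spacetime k) =
      (Fin.cons q (i.removeNth p) : Fin (n + 1) → Spacetime k) := by
  funext j
  refine Fin.cases ?_ (fun j => ?_) j <;> simp [Fin.removeNth]

theorem integrable_contraction (R R' : DeformationFunction)
    (Q Q' : Matrix (Fin (k + 2)) (Fin (k + 2)) ℝ)
    {φ χ : Spacetime k → ℂ} (hφ : MemLp φ 2 (shellMeasure k m))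
    (hχ : MemLp χ 2 (shellMeasure k m)) {n : ℕ} (p : Fin n → Spacetime k) :
    Integrable (fun q => conj (φ q) * χ q *
      (multiplier R (Q *ᵥ q) p * conj (multiplier R' (Q' *ᵥ q) p))) (shellMeasure k m) := by
  have hc : ∀ (R : DeformationFunction) (Q : Matrix (Fin (k + 2)) (Fin (k + 2)) ℝ),
      Continuous fun q : Spacetime k => multiplier R (Q *ᵥ q) p :=
    fun R Q => (continuous_multiplier R Q n).comp (Continuous.prodMk_left p)
  refine (MemLp.integrable_mul (p := 2) (q := 2) hφ.star hχ).mul_bdd (c := 1)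
    ((hc R Q).mul (Complex.continuous_conj.comp (hc R' Q'))).aestronglyMeasurable
    (Filter.Eventually.of_forall fun q => ?_)
  simp [norm_multiplier]

/-- The creation operator either puts its wave function on the new momentum q, which produces the
integrand of the contraction, or on some pᵢ. In the second case the index of pᵢ is shifted by one,
which costs a sign, and the two phases relating q and pᵢ multiply to R(Qq·pᵢ) · (-conj R(Qq·pᵢ)) =
-1. The signs cancel, which is why commutators appear. The scalar a stands for the conjugate wave
function of the annihilator. -/
theorem creationFun_cons {R R' : DeformationFunction}
    {Q Q' : Matrix (Fin (k + 2)) (Fin (k + 2)) ℝ} (hR : OppositeDeformation R R' Q Q')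
    (χ : Spacetime k → ℂ) {n : ℕ} (Ψ : (Fin (n + 1) → Spacetime k) → ℂ)
    (p : Fin (n + 1) → Spacetime k) (a : ℂ) (q : Spacetime k) :
    a * (multiplier R (Q *ᵥ q) p * creationFun R' Q' χ Ψ (Fin.cons q p)) =
      ((Real.sqrt ((n + 1 : ℕ) + 1) : ℝ) : ℂ)⁻¹ *
      (a * χ q * (multiplier R (Q *ᵥ q) p * conj (multiplier R' (Q' *ᵥ q) p)) * Ψ p +
        ∑ i : Fin (n + 1), (-1) ^ (i : ℕ) *
          (χ (p i) * conj (multiplier R' (Q' *ᵥ p i) (i.removeNth p))) *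
          (a * (multiplier R (Q *ᵥ q) (i.removeNth p) *
            Ψ (Fin.cons q (i.removeNth p))))) := by
  have h0 : Fin.removeNth 0 (Fin.cons q p : Fin (n + 2) → Spacetime k) = p := by
    funext j
    simp [Fin.removeNth]
  rw [creationFun, Fin.sum_univ_succ, h0]
  simp only [mul_add, Fin.val_zero, pow_zero, Fin.cons_zero]
  refine congrArg₂ (· + ·) (by ring) ?_
  simp only [Finset.mul_sum]
  refine Finset.sum_congr rfl fun i _ => ?_
  have hu := R.unimodular (mink (Q *ᵥ q) (p i))
  rw [removeNth_succ_cons, Fin.cons_succ, multiplier_cons, hR.exchange,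
    multiplier_removeNth R _ p i]
  simp only [map_mul, map_neg, Fin.val_succ, pow_succ]
  linear_combination (((Real.sqrt ((n + 1 : ℕ) + 1) : ℝ) : ℂ)⁻¹ * a *
    multiplier R (Q *ᵥ q) (i.removeNth p) *
    Ψ (Fin.cons q (i.removeNth p)) * (-1) ^ (i : ℕ) * χ (p i) *
    conj (multiplier R' (Q' *ᵥ p i) (i.removeNth p))) * hu

theorem annihilationFun_creationFun {R R' : DeformationFunction}
    {Q Q' : Matrix (Fin (k + 2)) (Fin (k + 2)) ℝ} (hR : OppositeDeformation R R' Q Q')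
    {φ χ : Spacetime k → ℂ} (hφ : MemLp φ 2 (shellMeasure k m))
    (hχ : MemLp χ 2 (shellMeasure k m)) {n : ℕ} {Ψ : (Fin (n + 1) → Spacetime k) → ℂ}
    (hΨ : MemLp Ψ 2 (shellMeasureN k m (n + 1))) :
    annihilationFun m R Q φ (creationFun R' Q' χ Ψ) =ᵐ[shellMeasureN k m (n + 1)]
      fun p => contraction m R R' Q Q' φ χ p * Ψ p +
        creationFun R' Q' χ (annihilationFun m R Q φ Ψ) p := by
  have hj : ∀ᵐ p ∂(shellMeasureN k m (n + 1)), ∀ j : Fin (n + 1),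
      Integrable (fun q => conj (φ q) * (multiplier R (Q *ᵥ q) (j.removeNth p) *
        Ψ (Fin.cons q (j.removeNth p)))) (shellMeasure k m) :=
    ae_all_iff.2 fun j =>
      (quasiMeasurePreserving_removeNth m j).ae (ae_integrable_cons R Q hφ hΨ)
  have hne : ∀ l : ℕ, ((Real.sqrt ((l : ℝ) + 1) : ℝ) : ℂ) ≠ 0 := fun l =>
    Complex.ofReal_ne_zero.2 (Real.sqrt_pos.2 (Nat.cast_add_one_pos l)).ne'
  filter_upwards [hj] with p hp
  rw [annihilationFun]
  simp only [creationFun_cons hR]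
  -- The root √(n+2) of the outer annihilator cancels the normalization of the creator. In the
  -- reordered product the corresponding factors are √(n+1) and its inverse, which cancel in the
  -- last step.
  rw [integral_const_mul, mul_inv_cancel_left₀ (hne (n + 1)),
    integral_add ((integrable_contraction R R' Q Q' hφ hχ p).mul_const _)
    (integrable_finsetSum _ fun i _ => (hp i).const_mul _), integral_mul_const,
    integral_finsetSum _ fun i _ => (hp i).const_mul _, contraction]
  refine congrArg₂ (· + ·) rfl ?_
  rw [creationFun, Finset.mul_sum]
  refine Finset.sum_congr rfl fun i _ => ?_
  rw [integral_const_mul, annihilationFun]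
  generalize (∫ q, conj (φ q) * (multiplier R (Q *ᵥ q) (i.removeNth p) *
    Ψ (Fin.cons q (i.removeNth p))) ∂(shellMeasure k m)) = J
  linear_combination -((-1) ^ (i : ℕ) * χ (p i) *
    conj (multiplier R' (Q' *ᵥ p i) (i.removeNth p)) * J) * inv_mul_cancel₀ (hne n)

/-! ### From wave functions to operators on the particle spaces -/

theorem coeFn_creation (R : DeformationFunction)
    (Q : Matrix (Fin (k + 2)) (Fin (k + 2)) ℝ) (φ : OneParticle k m) (n : ℕ)
    (Ψ : nParticle k m n) :
    ((creation R Q φ n Ψ).1 : (Fin (n + 1) → Spacetime k) → ℂ) =ᵐ[shellMeasureN k m (n + 1)]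
      creationFun R Q φ Ψ.1 :=
  (memLp_creationFun R Q (Lp.memLp φ) (Lp.memLp Ψ.1)).coeFn_toLp

theorem coeFn_annihilation (R : DeformationFunction)
    (Q : Matrix (Fin (k + 2)) (Fin (k + 2)) ℝ) (φ : OneParticle k m) (n : ℕ)
    (Ψ : nParticle k m (n + 1)) :
    ((annihilation R Q φ n Ψ).1 : (Fin n → Spacetime k) → ℂ) =ᵐ[shellMeasureN k m n]
      annihilationFun m R Q φ Ψ.1 :=
  (memLp_annihilationFun R Q (Lp.memLp φ) (Lp.memLp Ψ.1)).coeFn_toLp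

theorem annihilation_comm {R R' : DeformationFunction}
    {Q Q' : Matrix (Fin (k + 2)) (Fin (k + 2)) ℝ} (hR : OppositeDeformation R R' Q Q')
    (φ χ : OneParticle k m) (n : ℕ) (Ψ : nParticle k m (n + 2)) :
    annihilation R Q φ n (annihilation R' Q' χ (n + 1) Ψ) =
      annihilation R' Q' χ n (annihilation R Q φ (n + 1) Ψ) := by
  refine Subtype.ext (Lp.ext ?_)
  exact ((coeFn_annihilation R Q φ n _).trans
    (annihilationFun_congr R Q φ (coeFn_annihilation R' Q' χ (n + 1) Ψ))).trans
    ((annihilationFun_comm hR (Lp.memLp φ) (Lp.memLp χ) (Lp.memLp Ψ.1) Ψ.2).trans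
    ((coeFn_annihilation R' Q' χ n _).trans
    (annihilationFun_congr R' Q' χ (coeFn_annihilation R Q φ (n + 1) Ψ))).symm)

theorem creation_comm {R R' : DeformationFunction}
    {Q Q' : Matrix (Fin (k + 2)) (Fin (k + 2)) ℝ} (hR : OppositeDeformation R R' Q Q')
    (φ χ : OneParticle k m) (n : ℕ) (Ψ : nParticle k m n) :
    creation R Q φ (n + 1) (creation R' Q' χ n Ψ) =
      creation R' Q' χ (n + 1) (creation R Q φ n Ψ) := by
  -- Moving all four creators to the other side of the inner product leaves the commutation of
  -- annihilators.
  refine ext_inner_right ℂ fun Φ => ?_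
  rw [inner_creation, inner_creation, inner_creation, inner_creation, annihilation_comm hR]

theorem coeFn_annihilation_creation_zero (R R' : DeformationFunction)
    (Q Q' : Matrix (Fin (k + 2)) (Fin (k + 2)) ℝ) (φ χ : OneParticle k m)
    (Ψ : nParticle k m 0) :
    ((annihilation R Q φ 0 (creation R' Q' χ 0 Ψ)).1 : (Fin 0 → Spacetime k) → ℂ)
      =ᵐ[shellMeasureN k m 0] fun p => contraction m R R' Q Q' φ χ p * Ψ.1 p :=
  ((coeFn_annihilation R Q φ 0 _).trans
    (annihilationFun_congr R Q φ (coeFn_creation R' Q' χ 0 Ψ))).trans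
    (Filter.Eventually.of_forall fun p => annihilationFun_creationFun_zero R R' Q Q' φ χ _ p)

theorem coeFn_annihilation_creation {R R' : DeformationFunction}
    {Q Q' : Matrix (Fin (k + 2)) (Fin (k + 2)) ℝ} (hR : OppositeDeformation R R' Q Q')
    (φ χ : OneParticle k m) (n : ℕ) (Ψ : nParticle k m (n + 1)) :
    ((annihilation R Q φ (n + 1) (creation R' Q' χ (n + 1) Ψ) -
        creation R' Q' χ n (annihilation R Q φ n Ψ)).1 : (Fin (n + 1) → Spacetime k) → ℂ)
      =ᵐ[shellMeasureN k m (n + 1)] fun p => contraction m R R' Q Q' φ χ p * Ψ.1 p := by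
  have h1 := ((coeFn_annihilation R Q φ (n + 1) _).trans
    (annihilationFun_congr R Q φ (coeFn_creation R' Q' χ (n + 1) Ψ))).trans
    (annihilationFun_creationFun hR (Lp.memLp φ) (Lp.memLp χ) (Lp.memLp Ψ.1))
  have h2 := (coeFn_creation R' Q' χ n (annihilation R Q φ n Ψ)).trans
    (creationFun_congr R' Q' χ (coeFn_annihilation R Q φ n Ψ))
  rw [Submodule.coe_sub]
  filter_upwards [Lp.coeFn_sub (annihilation R Q φ (n + 1) (creation R' Q' χ (n + 1) Ψ)).1
    (creation R' Q' χ n (annihilation R Q φ n Ψ)).1, h1, h2] with p hp e1 e2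
  rw [hp, Pi.sub_apply, e1, e2, add_sub_cancel_right]

/-- Bookkeeping for the terms of a product of two fields: a and c are the annihilator-creator
products, b and d the creator-annihilator products with the same pairs of operators, and x, x' the
products of two annihilators. -/
theorem add_rearrange_of_sub_eq_sub {A : Type*} [AddCommGroup A] {a b c d x x' : A}
    (h : a - b = c - d) (hx : x = x') : d + (a + x) = b + (c + x') := by
  rw [← add_assoc, ← add_assoc, add_comm d, sub_eq_sub_iff_add_eq_add.1 h, add_comm c, hx]

/-- Opposite fields commute if their contractions agree almost everywhere. -/
theorem field_comm_of_contraction_eq (hm : 0 < m) {R R' : DeformationFunction}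
    {Q Q' : Matrix (Fin (k + 2)) (Fin (k + 2)) ℝ} (hR : OppositeDeformation R R' Q Q')
    (f g : 𝓢(Spacetime k, ℂ))
    (h : ∀ n, ∀ᵐ p ∂(shellMeasureN k m n),
      contraction m R R' Q Q' (conjMinusVector hm f) (plusVector hm g) p =
        contraction m R' R Q' Q (conjMinusVector hm g) (plusVector hm f) p)
    (Ψ : finiteParticle k m) :
    field hm R Q f (field hm R' Q' g Ψ) = field hm R' Q' g (field hm R Q f Ψ) := by
  refine Subtype.ext (lp.ext (funext fun n => ?_))
  have hzero : ∀ Φ : nParticle k m 0,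
      annihilation R Q (conjMinusVector hm f) 0 (creation R' Q' (plusVector hm g) 0 Φ) =
      annihilation R' Q' (conjMinusVector hm g) 0 (creation R Q (plusVector hm f) 0 Φ) := by
    intro Φ
    refine Subtype.ext (Lp.ext ?_)
    filter_upwards [h 0,
      coeFn_annihilation_creation_zero R R' Q Q' (conjMinusVector hm f) (plusVector hm g) Φ,
      coeFn_annihilation_creation_zero R' R Q' Q (conjMinusVector hm g) (plusVector hm f) Φ]
      with p h0 h1 h2
    rw [h1, h2, h0]
  have hsucc : ∀ (n : ℕ) (Φ : nParticle k m (n + 1)),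
      annihilation R Q (conjMinusVector hm f) (n + 1)
          (creation R' Q' (plusVector hm g) (n + 1) Φ) -
        creation R' Q' (plusVector hm g) n (annihilation R Q (conjMinusVector hm f) n Φ) =
      annihilation R' Q' (conjMinusVector hm g) (n + 1)
          (creation R Q (plusVector hm f) (n + 1) Φ) -
        creation R Q (plusVector hm f) n (annihilation R' Q' (conjMinusVector hm g) n Φ) := by
    intro n Φ
    refine Subtype.ext (Lp.ext ?_)
    filter_upwards [h (n + 1),
      coeFn_annihilation_creation hR (conjMinusVector hm f) (plusVector hm g) n Φ,
      coeFn_annihilation_creation hR.symm (conjMinusVector hm g) (plusVector hm f) n Φ]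
      with p h0 h1 h2
    rw [h1, h2, h0]
  change fieldComponent hm R Q f (fieldComponent hm R' Q' g fun n => Ψ.1 n) n =
    fieldComponent hm R' Q' g (fieldComponent hm R Q f fun n => Ψ.1 n) n
  -- The number of terms depends on the component: a creator maps into particle number at least one,
  -- and two creators into at least two.
  match n with
  | 0 =>
    simp only [fieldComponent, map_add]
    rw [hzero, annihilation_comm hR]
  | 1 =>
    simp only [fieldComponent, map_add]
    exact add_rearrange_of_sub_eq_sub (hsucc 0 (Ψ.1 1)) (annihilation_comm hR _ _ 1 (Ψ.1 3))
  | n + 2 =>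
    simp only [fieldComponent, map_add]
    refine (add_assoc _ _ _).trans ((congrArg₂ (· + ·)
      (creation_comm hR (plusVector hm f) (plusVector hm g) n (Ψ.1 n)) ?_).trans
      (add_assoc _ _ _).symm)
    exact add_rearrange_of_sub_eq_sub (hsucc (n + 1) (Ψ.1 (n + 2)))
      (annihilation_comm hR _ _ (n + 2) (Ψ.1 (n + 4)))

open Filter Topology

/-! ### Shifting the contour across a strip -/

/-- The closed strip `0 ≤ Im z ≤ π`. -/
def closedStrip : Set ℂ := {z | 0 ≤ z.im ∧ z.im ≤ Real.pi}

/-- The open strip `0 < Im z < π`. -/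
def openStrip : Set ℂ := {z | 0 < z.im ∧ z.im < Real.pi}

theorem isOpen_openStrip : IsOpen openStrip :=
  (isOpen_lt continuous_const Complex.continuous_im).inter
    (isOpen_lt Complex.continuous_im continuous_const)

theorem openStrip_subset : openStrip ⊆ closedStrip := fun _ hz => ⟨hz.1.le, hz.2.le⟩

/-- Bounded continuous functions on the closed strip which are analytic in the interior. -/
structure IsStripAnalytic (H : ℂ → ℂ) : Prop where
  continuousOn : ContinuousOn H closedStrip
  differentiableOn : DifferentiableOn ℂ H openStrip
  bounded : ∃ C, ∀ z ∈ closedStrip, ‖H z‖ ≤ C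

theorem IsStripAnalytic.mul {H G : ℂ → ℂ} (hH : IsStripAnalytic H) (hG : IsStripAnalytic G) :
    IsStripAnalytic fun z => H z * G z := by
  refine ⟨hH.continuousOn.mul hG.continuousOn, hH.differentiableOn.mul hG.differentiableOn, ?_⟩
  obtain ⟨C, hC⟩ := hH.bounded
  obtain ⟨D, hD⟩ := hG.bounded
  refine ⟨C * D, fun z hz => ?_⟩
  rw [norm_mul]
  exact mul_le_mul (hC z hz) (hD z hz) (norm_nonneg _) ((norm_nonneg _).trans (hC z hz))

theorem isStripAnalytic_const (c : ℂ) : IsStripAnalytic fun _ => c :=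
  ⟨continuousOn_const, differentiableOn_const c, ‖c‖, fun _ _ => le_rfl⟩

theorem IsStripAnalytic.finset_prod {ι : Type*} (s : Finset ι) {H : ι → ℂ → ℂ}
    (hH : ∀ i, IsStripAnalytic (H i)) : IsStripAnalytic fun z => ∏ i ∈ s, H i z := by
  classical
  induction s using Finset.induction_on with
  | empty => simpa using isStripAnalytic_const 1
  | insert i s hi ih =>
    simp only [Finset.prod_insert hi]
    exact (hH i).mul ih

/-- Since Re z² = (Re z)² - (Im z)² and Im z stays below π, the Gaussian decays along the strip
uniformly in the imaginary part. -/
theorem norm_exp_neg_mul_sq {ε : ℝ} (hε : 0 ≤ ε) {z : ℂ} (hz : z ∈ closedStrip) :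
    ‖Complex.exp (-ε * z ^ 2)‖ ≤ Real.exp (ε * Real.pi ^ 2) * Real.exp (-ε * z.re ^ 2) := by
  rw [Complex.norm_exp, ← Real.exp_add, Real.exp_le_exp]
  have h : (-(ε : ℂ) * z ^ 2).re = -ε * (z.re ^ 2 - z.im ^ 2) := by
    simp [pow_two, Complex.mul_re, Complex.mul_im]
  have h2 : z.im ^ 2 ≤ Real.pi ^ 2 := pow_le_pow_left₀ hz.1 hz.2 2
  rw [h]
  nlinarith

theorem ofReal_mem_closedStrip (x : ℝ) : (x : ℂ) ∈ closedStrip := by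
  simp [closedStrip, Real.pi_pos.le]

theorem add_pi_mem_closedStrip (x : ℝ) : (x + Real.pi * Complex.I : ℂ) ∈ closedStrip := by
  simp [closedStrip, Real.pi_pos.le]

/-- Cauchy's theorem on the rectangles [-T, T] × [0, π]. Boundedness alone would not make the
vertical sides negligible as T → ∞; the Gaussian factor does. -/
theorem IsStripAnalytic.integral_gaussian_eq {H : ℂ → ℂ} (hH : IsStripAnalytic H)
    (h0 : Integrable fun x : ℝ => H x)
    (h1 : Integrable fun x : ℝ => H (x + Real.pi * Complex.I)) {ε : ℝ} (hε : 0 < ε) :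
    ∫ x : ℝ, Complex.exp (-ε * (x : ℂ) ^ 2) * H x =
      ∫ x : ℝ, Complex.exp (-ε * (x + Real.pi * Complex.I : ℂ) ^ 2) *
        H (x + Real.pi * Complex.I) := by
  obtain ⟨C, hC⟩ := hH.bounded
  have hC0 : 0 ≤ C := (norm_nonneg _).trans (hC 0 (by simpa using ofReal_mem_closedStrip 0))
  set G : ℂ → ℂ := fun z => Complex.exp (-ε * z ^ 2) * H z with hG
  have hexp : Differentiable ℂ fun z : ℂ => Complex.exp (-ε * z ^ 2) := by fun_prop
  have hGb : ∀ z ∈ closedStrip,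
      ‖G z‖ ≤ C * Real.exp (ε * Real.pi ^ 2) * Real.exp (-ε * z.re ^ 2) := by
    intro z hz
    rw [hG, norm_mul]
    calc _ ≤ _ := mul_le_mul (norm_exp_neg_mul_sq hε.le hz) (hC z hz) (norm_nonneg _)
          (by positivity)
      _ = _ := by ring
  have hle : ∀ z ∈ closedStrip, ‖Complex.exp (-ε * z ^ 2)‖ ≤ Real.exp (ε * Real.pi ^ 2) := by
    intro z hz
    refine (norm_exp_neg_mul_sq hε.le hz).trans (mul_le_of_le_one_right (by positivity) ?_)
    rw [Real.exp_le_one_iff]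
    nlinarith [sq_nonneg z.re]
  have hi0 : Integrable fun x : ℝ => G x :=
    h0.bdd_mul (c := Real.exp (ε * Real.pi ^ 2))
      (hexp.continuous.comp Complex.continuous_ofReal).aestronglyMeasurable
      (Eventually.of_forall fun x => hle _ (ofReal_mem_closedStrip x))
  have hi1 : Integrable fun x : ℝ => G (x + Real.pi * Complex.I) :=
    h1.bdd_mul (c := Real.exp (ε * Real.pi ^ 2))
      (hexp.continuous.comp (by fun_prop :
        Continuous fun x : ℝ => (x + Real.pi * Complex.I : ℂ))).aestronglyMeasurable
      (Eventually.of_forall fun x => hle _ (add_pi_mem_closedStrip x))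
  have hrect : ∀ T : ℝ, 0 < T → (∫ x : ℝ in (-T)..T, G x) -
      (∫ x : ℝ in (-T)..T, G (x + Real.pi * Complex.I)) =
      Complex.I • (∫ y : ℝ in (0 : ℝ)..Real.pi, G (((-T : ℝ) : ℂ) + y * Complex.I)) -
      Complex.I • (∫ y : ℝ in (0 : ℝ)..Real.pi, G ((T : ℂ) + y * Complex.I)) := by
    intro T hT
    have h := Complex.integral_boundary_rect_eq_zero_of_continuousOn_of_differentiableOn G
      ((-T : ℝ) : ℂ) (T + Real.pi * Complex.I) ?_ ?_
    · simp only [Complex.ofReal_re, Complex.ofReal_im, Complex.add_re, Complex.add_im,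
        Complex.mul_re, Complex.mul_im, Complex.I_re, Complex.I_im, mul_zero, mul_one, zero_mul,
        sub_zero, add_zero, zero_add, Complex.ofReal_zero] at h
      linear_combination h
    · refine (hexp.continuous.continuousOn.mul hH.continuousOn).mono fun z hz => ?_
      have hz2 := (Complex.mem_reProdIm.1 hz).2
      rw [Set.uIcc_of_le (by simp [Real.pi_pos.le])] at hz2
      simpa [closedStrip] using hz2
    · refine (hexp.differentiableOn.mul hH.differentiableOn).mono fun z hz => ?_
      have hz2 := (Complex.mem_reProdIm.1 hz).2
      simpa [openStrip, Real.pi_pos.le] using hz2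
  -- The values s = 1 and s = -1 treat the right and the left side together.
  have hvert : ∀ s : ℝ, s ^ 2 = 1 → Tendsto (fun T : ℝ =>
      ∫ y : ℝ in (0 : ℝ)..Real.pi, G (((s * T : ℝ) : ℂ) + y * Complex.I)) atTop (𝓝 0) := by
    intro s hs
    have hbd : ∀ T : ℝ, ‖∫ y : ℝ in (0 : ℝ)..Real.pi, G (((s * T : ℝ) : ℂ) + y * Complex.I)‖ ≤
        C * Real.exp (ε * Real.pi ^ 2) * Real.exp (-ε * T ^ 2) * |Real.pi - 0| := by
      intro T
      refine intervalIntegral.norm_integral_le_of_norm_le_const fun y hy => ?_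
      rw [Set.uIoc_of_le Real.pi_pos.le] at hy
      have := hGb (((s * T : ℝ) : ℂ) + y * Complex.I) (by simpa [closedStrip] using ⟨hy.1.le, hy.2⟩)
      simpa [mul_pow, hs] using this
    refine squeeze_zero_norm hbd ?_
    have ht : Tendsto (fun T : ℝ => Real.exp (-ε * T ^ 2)) atTop (𝓝 0) := by
      refine Real.tendsto_exp_atBot.comp ?_
      exact (tendsto_pow_atTop two_ne_zero).const_mul_atTop_of_neg (neg_lt_zero.2 hε)
    simpa using (ht.const_mul (C * Real.exp (ε * Real.pi ^ 2))).mul_const |Real.pi - 0|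
  have hl0 := intervalIntegral_tendsto_integral hi0 tendsto_neg_atTop_atBot tendsto_id
  have hl1 := intervalIntegral_tendsto_integral hi1 tendsto_neg_atTop_atBot tendsto_id
  have hlim := ((hvert (-1) (by norm_num)).const_smul Complex.I).sub
    ((hvert 1 (by norm_num)).const_smul Complex.I)
  simp only [smul_zero, sub_zero] at hlim
  refine sub_eq_zero.1 (tendsto_nhds_unique (hl0.sub hl1) (hlim.congr' ?_))
  filter_upwards [eventually_gt_atTop 0] with T hT
  rw [id_eq, hrect T hT, neg_one_mul, one_mul]

/-- The Gaussian regulator is removed by dominated convergence as ε ↓ 0; for ε ≤ 1 it is bounded by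
exp(π²) on the strip, so integrability on the two boundary lines suffices. -/
theorem IsStripAnalytic.integral_eq {H : ℂ → ℂ} (hH : IsStripAnalytic H)
    (h0 : Integrable fun x : ℝ => H x)
    (h1 : Integrable fun x : ℝ => H (x + Real.pi * Complex.I)) :
    ∫ x : ℝ, H x = ∫ x : ℝ, H (x + Real.pi * Complex.I) := by
  have key : ∀ u : ℝ → ℂ, Continuous u → (∀ x, u x ∈ closedStrip) →
      Integrable (fun x => H (u x)) →
      Tendsto (fun ε : ℝ => ∫ x : ℝ, Complex.exp (-ε * u x ^ 2) * H (u x)) (𝓝[>] 0)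
        (𝓝 (∫ x : ℝ, H (u x))) := by
    intro u hu hus hi
    refine tendsto_integral_filter_of_dominated_convergence
      (fun x => Real.exp (Real.pi ^ 2) * ‖H (u x)‖) ?_ ?_ (hi.norm.const_mul _) ?_
    · refine Eventually.of_forall fun ε => AEStronglyMeasurable.mul ?_ hi.1
      exact (by fun_prop : Continuous fun x => Complex.exp (-ε * u x ^ 2)).aestronglyMeasurable
    · filter_upwards [Ioc_mem_nhdsGT (zero_lt_one' ℝ)] with ε hε
      refine Eventually.of_forall fun x => ?_
      rw [norm_mul]
      refine mul_le_mul_of_nonneg_right ?_ (norm_nonneg _)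
      refine (norm_exp_neg_mul_sq hε.1.le (hus x)).trans ?_
      rw [← Real.exp_add, Real.exp_le_exp]
      have h1 := hε.1
      have h2 := hε.2
      nlinarith [sq_nonneg (u x).re, sq_nonneg Real.pi,
        mul_nonneg h1.le (sq_nonneg (u x).re)]
    · refine Eventually.of_forall fun x => ?_
      have hc : Continuous fun ε : ℝ => Complex.exp (-ε * u x ^ 2) * H (u x) := by fun_prop
      have := (hc.tendsto 0).mono_left (nhdsWithin_le_nhds (s := Set.Ioi 0))
      simpa using this
  refine tendsto_nhds_unique (key (fun x => x) Complex.continuous_ofReal ofReal_mem_closedStrip h0)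
    ((key (fun x => x + Real.pi * Complex.I) (by fun_prop) add_pi_mem_closedStrip h1).congr' ?_)
  filter_upwards [self_mem_nhdsWithin] with ε hε
  exact (hH.integral_gaussian_eq h0 h1 hε).symm

/-! ### Fourier transforms of functions supported in the wedge -/

/-- The Minkowski product of `x` with the complex momentum
`(M cosh z, M sinh z, v)`. -/
noncomputable def rapidityPhase (M : ℝ) (v : Fin k → ℝ) (x : Spacetime k) (z : ℂ) : ℂ :=
  M * Complex.cosh z * x 0 - M * Complex.sinh z * x 1 - ∑ i : Fin k, (v i * x i.succ.succ : ℝ)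

/-- The Fourier transform `∫ f(x) exp(-i q·x) dx` at the complex momentum
`q = (M cosh z, M sinh z, v)`. -/
noncomputable def rapidityFourier (f : Spacetime k → ℂ) (M : ℝ) (v : Fin k → ℝ) (z : ℂ) : ℂ :=
  ∫ x, f x * Complex.exp (-Complex.I * rapidityPhase M v x z)

theorem cosh_im (z : ℂ) : (Complex.cosh z).im = Real.sinh z.re * Real.sin z.im := by
  conv_lhs => rw [← Complex.re_add_im z, Complex.cosh_add, Complex.cosh_mul_I, Complex.sinh_mul_I]
  simp [← Complex.ofReal_cosh, ← Complex.ofReal_sinh, ← Complex.ofReal_cos, ← Complex.ofReal_sin]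

theorem sinh_im (z : ℂ) : (Complex.sinh z).im = Real.cosh z.re * Real.sin z.im := by
  conv_lhs => rw [← Complex.re_add_im z, Complex.sinh_add, Complex.cosh_mul_I, Complex.sinh_mul_I]
  simp [← Complex.ofReal_cosh, ← Complex.ofReal_sinh, ← Complex.ofReal_cos, ← Complex.ofReal_sin]

/-- The pairing of the forward timelike direction of rapidity `θ` with the wedge. -/
theorem cosh_mul_sub_sinh_mul_pos {a b : ℝ} (h : |b| < a) (θ : ℝ) :
    0 < Real.cosh θ * a - Real.sinh θ * b := by
  have h1 : |Real.sinh θ| < Real.cosh θ := by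
    rw [abs_lt]
    constructor
    · have := Real.cosh_add_sinh θ
      have := Real.exp_pos θ
      linarith
    · exact Real.sinh_lt_cosh θ
  have h2 : Real.sinh θ * b ≤ |Real.sinh θ| * |b| := by
    rw [← abs_mul]
    exact le_abs_self _
  nlinarith [abs_nonneg (Real.sinh θ), abs_nonneg b]

/-- The imaginary part of the complex momentum is M sin(Im z) (sinh(Re z), cosh(Re z), 0). Its
Minkowski product with a point of the right wedge is nonpositive because sin ≥ 0 on [0, π], so the
exponential is damped. -/
theorem norm_exp_rapidityPhase_le {M : ℝ} (hM : 0 ≤ M) (v : Fin k → ℝ) {x : Spacetime k}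
    (hx : x ∈ rightWedge k) {z : ℂ} (hz : z ∈ closedStrip) :
    ‖Complex.exp (-Complex.I * rapidityPhase M v x z)‖ ≤ 1 := by
  rw [Complex.norm_exp, Real.exp_le_one_iff]
  have h : (-Complex.I * rapidityPhase M v x z).re =
      -(M * Real.sin z.im * (Real.cosh z.re * x 1 - Real.sinh z.re * x 0)) := by
    simp only [rapidityPhase, Complex.mul_re, Complex.neg_re, Complex.neg_im, Complex.I_re,
      Complex.I_im, Complex.sub_im, Complex.mul_im, Complex.ofReal_re, Complex.ofReal_im, cosh_im,
      sinh_im, Complex.sub_re]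
    ring
  rw [h, neg_nonpos]
  exact mul_nonneg (mul_nonneg hM (Real.sin_nonneg_of_nonneg_of_le_pi hz.1 hz.2))
    (cosh_mul_sub_sinh_mul_pos hx _).le

theorem continuous_rapidityPhase (M : ℝ) (v : Fin k → ℝ) (z : ℂ) :
    Continuous fun x : Spacetime k => rapidityPhase M v x z := by
  unfold rapidityPhase
  fun_prop

theorem hasDerivAt_rapidityPhase (M : ℝ) (v : Fin k → ℝ) (x : Spacetime k) (z : ℂ) :
    HasDerivAt (rapidityPhase M v x) (M * Complex.sinh z * x 0 - M * Complex.cosh z * x 1) z :=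
  ((((Complex.hasDerivAt_cosh z).const_mul _).mul_const _).sub
    (((Complex.hasDerivAt_sinh z).const_mul _).mul_const _)).sub_const _

theorem norm_mul_exp_rapidityPhase_le {M : ℝ} (hM : 0 ≤ M) (v : Fin k → ℝ)
    {f : Spacetime k → ℂ} (hf : ∀ x, x ∉ rightWedge k → f x = 0) (x : Spacetime k) {z : ℂ}
    (hz : z ∈ closedStrip) :
    ‖f x * Complex.exp (-Complex.I * rapidityPhase M v x z)‖ ≤ ‖f x‖ := by
  by_cases hx : x ∈ rightWedge k
  · rw [norm_mul]
    exact mul_le_of_le_one_right (norm_nonneg _) (norm_exp_rapidityPhase_le hM v hx hz)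
  · simp [hf x hx]

/-- The support in the wedge makes ‖f‖ a majorant for all z in the closed strip, which gives
boundedness and continuity. The derivative in z brings down only a factor linear in x, so the decay
of f permits differentiation under the integral. -/
theorem isStripAnalytic_rapidityFourier {M : ℝ} (hM : 0 ≤ M) (v : Fin k → ℝ)
    (f : 𝓢(Spacetime k, ℂ)) (hf : ∀ x, x ∉ rightWedge k → f x = 0) :
    IsStripAnalytic (rapidityFourier f M v) := by
  have hmeas : ∀ z, AEStronglyMeasurable
      (fun x => f x * Complex.exp (-Complex.I * rapidityPhase M v x z)) volume := fun z =>
    (f.continuous.mul (Complex.continuous_exp.comp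
      (continuous_const.mul (continuous_rapidityPhase M v z)))).aestronglyMeasurable
  refine ⟨?_, ?_, ∫ x, ‖f x‖, ?_⟩
  · refine continuousOn_of_dominated (bound := fun x => ‖f x‖) (fun z _ => hmeas z)
      (fun z hz => Eventually.of_forall fun x => norm_mul_exp_rapidityPhase_le hM v hf x hz)
      f.integrable.norm (Eventually.of_forall fun x => ?_)
    have : Continuous (rapidityPhase M v x) :=
      continuous_iff_continuousAt.2 fun z => (hasDerivAt_rapidityPhase M v x z).continuousAt
    exact (by fun_prop : Continuous fun z =>
      f x * Complex.exp (-Complex.I * rapidityPhase M v x z)).continuousOn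
  · intro z₀ hz₀
    -- B bounds the coefficients of x⁰ and x¹ in the derivative of the phase near z₀; the majorant
    -- of the derivative is then 2B ‖x‖ ‖f x‖.
    obtain ⟨B, hB⟩ := (isCompact_closedBall z₀ 1).exists_bound_of_continuousOn
      (f := fun z : ℂ => (M * Complex.sinh z, M * Complex.cosh z))
      (by fun_prop)
    have hs : openStrip ∩ Metric.ball z₀ 1 ∈ 𝓝 z₀ :=
      inter_mem (isOpen_openStrip.mem_nhds hz₀) (Metric.ball_mem_nhds _ one_pos)
    have hbound : Integrable (fun x : Spacetime k => 2 * B * (‖x‖ ^ 1 * ‖f x‖)) :=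
      (f.integrable_pow_mul volume 1).const_mul _
    refine (hasDerivAt_integral_of_dominated_loc_of_deriv_le
      (F := fun z x => f x * Complex.exp (-Complex.I * rapidityPhase M v x z))
      (F' := fun z x => f x * (Complex.exp (-Complex.I * rapidityPhase M v x z) *
        (-Complex.I * (M * Complex.sinh z * x 0 - M * Complex.cosh z * x 1)))) hs
      (Eventually.of_forall hmeas) ?_ ?_ (Eventually.of_forall fun x z hz => ?_) hbound
      (Eventually.of_forall fun x z hz => ?_)).2.differentiableAt.differentiableWithinAt
    · exact f.integrable.mono (hmeas z₀) (Eventually.of_forall fun x =>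
        norm_mul_exp_rapidityPhase_le hM v hf x (openStrip_subset hz₀))
    · refine Continuous.aestronglyMeasurable ?_
      have := continuous_rapidityPhase M v z₀
      have := f.continuous
      fun_prop
    · have h1 := norm_mul_exp_rapidityPhase_le hM v hf x (openStrip_subset hz.1)
      have h2 := hB z (Metric.ball_subset_closedBall hz.2)
      have h3 : ‖(M * Complex.sinh z : ℂ)‖ ≤ B := (norm_fst_le _).trans h2
      have h4 : ‖(M * Complex.cosh z : ℂ)‖ ≤ B := (norm_snd_le _).trans h2
      have hB0 : 0 ≤ B := (norm_nonneg _).trans h3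
      have h5 : ‖(M * Complex.sinh z * x 0 - M * Complex.cosh z * x 1 : ℂ)‖ ≤ 2 * B * ‖x‖ := by
        refine (norm_sub_le _ _).trans ?_
        rw [norm_mul, norm_mul (_ * _) (x 1 : ℂ), Complex.norm_real, Complex.norm_real]
        have e0 := norm_le_pi_norm x 0
        have e1 := norm_le_pi_norm x 1
        calc _ ≤ B * ‖x‖ + B * ‖x‖ := by gcongr
          _ = _ := by ring
      rw [← mul_assoc, norm_mul, norm_mul (-Complex.I), norm_neg, Complex.norm_I, one_mul, pow_one]
      calc _ ≤ ‖f x‖ * (2 * B * ‖x‖) := mul_le_mul h1 h5 (norm_nonneg _) (norm_nonneg _)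
        _ = _ := by ring
    · exact (((hasDerivAt_rapidityPhase M v x z).const_mul (-Complex.I)).cexp).const_mul _
  · intro z hz
    exact norm_integral_le_of_norm_le f.integrable.norm
      (Eventually.of_forall fun x => norm_mul_exp_rapidityPhase_le hM v hf x hz)

/-! ### Bounded analytic functions on the upper half plane -/

/-- Bounded continuous functions on the closed upper half plane which are analytic in the
interior. -/
structure IsHalfPlaneAnalytic (F : ℂ → ℂ) : Prop where
  continuousOn : ContinuousOn F {z | 0 ≤ z.im}
  differentiableOn : DifferentiableOn ℂ F {z | 0 < z.im}
  bounded : ∃ C, ∀ z : ℂ, 0 ≤ z.im → ‖F z‖ ≤ C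

theorem IsHalfPlaneAnalytic.mul {F G : ℂ → ℂ} (hF : IsHalfPlaneAnalytic F)
    (hG : IsHalfPlaneAnalytic G) : IsHalfPlaneAnalytic fun z => F z * G z := by
  refine ⟨hF.continuousOn.mul hG.continuousOn, hF.differentiableOn.mul hG.differentiableOn, ?_⟩
  obtain ⟨C, hC⟩ := hF.bounded
  obtain ⟨D, hD⟩ := hG.bounded
  refine ⟨C * D, fun z hz => ?_⟩
  rw [norm_mul]
  exact mul_le_mul (hC z hz) (hD z hz) (norm_nonneg _) ((norm_nonneg _).trans (hC z hz))

/-- The reflection z ↦ -conj z preserves the upper half plane, and the two conjugations together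
keep analyticity. On the real line this is a ↦ conj F(-a), the second factor in the contraction. -/
theorem IsHalfPlaneAnalytic.conj_neg_conj {F : ℂ → ℂ} (hF : IsHalfPlaneAnalytic F) :
    IsHalfPlaneAnalytic fun z => conj (F (-conj z)) := by
  refine ⟨?_, ?_, ?_⟩
  · refine Complex.continuous_conj.comp_continuousOn (hF.continuousOn.comp
      Complex.continuous_conj.neg.continuousOn fun z hz => ?_)
    simpa using hz
  · intro z hz
    have hz' : 0 < (-conj z).im := by simpa using hz
    have h1 : DifferentiableAt ℂ F (-conj z) :=
      (hF.differentiableOn _ hz').differentiableAt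
        ((isOpen_lt continuous_const Complex.continuous_im).mem_nhds hz')
    have h2 : DifferentiableAt ℂ (fun w => F (-w)) (conj z) :=
      DifferentiableAt.comp (conj z) h1 differentiable_neg.differentiableAt
    have h3 := h2.conj_conj
    rw [Complex.conj_conj] at h3
    exact h3.differentiableWithinAt
  · obtain ⟨C, hC⟩ := hF.bounded
    refine ⟨C, fun z hz => ?_⟩
    rw [RCLike.norm_conj]
    exact hC _ (by simpa using hz)

/-- The deformation phase `Qq·p` along the complex rapidity curve. -/
noncomputable def deformationPhase (a : ℝ) (p : Spacetime k) (c : ℝ) (z : ℂ) : ℂ :=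
  a * (Complex.sinh z * p 0 - Complex.cosh z * p 1) + c

theorem deformationPhase_im (a : ℝ) (p : Spacetime k) (c : ℝ) (z : ℂ) :
    (deformationPhase a p c z).im =
      a * (Real.sin z.im * (Real.cosh z.re * p 0 - Real.sinh z.re * p 1)) := by
  simp only [deformationPhase, Complex.add_im, Complex.mul_im, Complex.sub_im, Complex.ofReal_re,
    Complex.ofReal_im, cosh_im, sinh_im]
  ring

/-- Here the sign of κ enters: a will be κ times the transverse mass, and a ≥ 0 with p⁰ > |p¹| keeps
the phase in the closed upper half plane throughout the strip. -/
theorem isStripAnalytic_comp_deformationPhase {S : ℂ → ℂ} (hS : IsHalfPlaneAnalytic S) {a : ℝ}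
    (ha : 0 ≤ a) {p : Spacetime k} (hp : |p 1| < p 0) (c : ℝ) :
    IsStripAnalytic fun z => S (deformationPhase a p c z) := by
  have hd : Differentiable ℂ (deformationPhase a p c) := by
    unfold deformationPhase
    fun_prop
  have hm : ∀ z ∈ closedStrip, 0 ≤ (deformationPhase a p c z).im := by
    intro z hz
    rw [deformationPhase_im]
    exact mul_nonneg ha (mul_nonneg (Real.sin_nonneg_of_nonneg_of_le_pi hz.1 hz.2)
      (cosh_mul_sub_sinh_mul_pos hp _).le)
  refine ⟨hS.continuousOn.comp hd.continuous.continuousOn hm, ?_, ?_⟩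
  -- For a = 0 the phase is the real constant c, where `S` need not be differentiable, but the
  -- composition is constant. For a > 0 the open strip goes into the open half plane.
  · rcases ha.eq_or_lt with rfl | ha
    · simp [deformationPhase]
    · refine hS.differentiableOn.comp hd.differentiableOn fun z hz => ?_
      change 0 < (deformationPhase a p c z).im
      rw [deformationPhase_im]
      exact mul_pos ha (mul_pos (Real.sin_pos_of_pos_of_lt_pi hz.1 hz.2)
        (cosh_mul_sub_sinh_mul_pos hp _))
  · obtain ⟨C, hC⟩ := hS.bounded
    exact ⟨C, fun z hz => hC _ (hm z hz)⟩

/-! ### Rapidity coordinates on the mass shell -/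

/-- The transverse mass `√(v² + m²)`. -/
noncomputable def transverseMass (m : ℝ) (v : Fin k → ℝ) : ℝ := Real.sqrt (∑ i, v i ^ 2 + m ^ 2)

theorem transverseMass_pos (hm : 0 < m) (v : Fin k → ℝ) : 0 < transverseMass m v :=
  Real.sqrt_pos.2 (by positivity)

theorem transverseMass_neg (m : ℝ) (v : Fin k → ℝ) :
    transverseMass m (-v) = transverseMass m v := by
  simp [transverseMass]

/-- The point of the mass shell with transverse momentum `v` and rapidity `θ`. -/
noncomputable def rapidityPoint (m : ℝ) (v : Fin k → ℝ) (θ : ℝ) : Spacetime k :=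
  Fin.cons (transverseMass m v * Real.cosh θ) (Fin.cons (transverseMass m v * Real.sinh θ) v)

/-- This is cosh² - sinh² = 1, multiplied by the square of the transverse mass. -/
theorem energy_rapidity (hm : 0 < m) (v : Fin k → ℝ) (θ : ℝ) :
    energy m (Fin.cons (transverseMass m v * Real.sinh θ) v : Fin (k + 1) → ℝ) =
      transverseMass m v * Real.cosh θ := by
  have hM := transverseMass_pos hm v
  have hsq : transverseMass m v ^ 2 = ∑ i, v i ^ 2 + m ^ 2 := Real.sq_sqrt (by positivity)
  rw [energy, Real.sqrt_eq_iff_mul_self_eq (by positivity)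
    (mul_nonneg hM.le (Real.cosh_pos θ).le), Fin.sum_univ_succ]
  simp only [Fin.cons_zero, Fin.cons_succ]
  rw [add_assoc, ← hsq]
  linear_combination -(transverseMass m v ^ 2) * Real.cosh_sq θ

theorem onShell_rapidity (hm : 0 < m) (v : Fin k → ℝ) (θ : ℝ) :
    onShell m (Fin.cons (transverseMass m v * Real.sinh θ) v : Fin (k + 1) → ℝ) =
      rapidityPoint m v θ := by
  rw [onShell, energy_rapidity hm, rapidityPoint]

theorem energy_pos (hm : 0 < m) (q : Fin (k + 1) → ℝ) : 0 < energy m q :=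
  Real.sqrt_pos.2 (by positivity)

theorem range_mul_sinh {M : ℝ} (hM : 0 < M) :
    (fun θ => M * Real.sinh θ) '' Set.univ = Set.univ := by
  refine Set.eq_univ_of_forall fun y => ⟨Real.arsinh (y / M), trivial, ?_⟩
  simp only [Real.sinh_arsinh]
  field_simp

theorem hasDerivWithinAt_mul_sinh (M : ℝ) (θ : ℝ) :
    HasDerivWithinAt (fun θ => M * Real.sinh θ) (M * Real.cosh θ) Set.univ θ :=
  ((Real.hasDerivAt_sinh θ).const_mul M).hasDerivWithinAt

theorem injOn_mul_sinh {M : ℝ} (hM : 0 < M) :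
    Set.InjOn (fun θ => M * Real.sinh θ) Set.univ := fun _ _ _ _ h =>
  Real.sinh_injective (mul_left_cancel₀ hM.ne' h)

/-- The Jacobian of y = M sinh θ is M cosh θ, which is the energy itself and cancels the density
1/ω: the invariant measure is flat in the rapidity. -/
theorem abs_smul_energy_rapidity (hm : 0 < m) (v : Fin k → ℝ) (u : Spacetime k → ℂ) (θ : ℝ) :
    |transverseMass m v * Real.cosh θ| •
      ((energy m (Fin.cons (transverseMass m v * Real.sinh θ) v : Fin (k + 1) → ℝ))⁻¹ •
        u (onShell m (Fin.cons (transverseMass m v * Real.sinh θ) v : Fin (k + 1) → ℝ))) =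
      u (rapidityPoint m v θ) := by
  have hpos : 0 < transverseMass m v * Real.cosh θ :=
    mul_pos (transverseMass_pos hm v) (Real.cosh_pos θ)
  rw [onShell_rapidity hm, energy_rapidity hm, abs_of_pos hpos, smul_smul,
    mul_inv_cancel₀ hpos.ne', one_smul]

theorem integral_rapidity (hm : 0 < m) (v : Fin k → ℝ) (u : Spacetime k → ℂ) :
    ∫ y : ℝ, (energy m (Fin.cons y v : Fin (k + 1) → ℝ))⁻¹ •
        u (onShell m (Fin.cons y v : Fin (k + 1) → ℝ)) =
      ∫ θ : ℝ, u (rapidityPoint m v θ) := by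
  have hM := transverseMass_pos hm v
  have h := integral_image_eq_integral_abs_deriv_smul MeasurableSet.univ
    (fun θ _ => hasDerivWithinAt_mul_sinh (transverseMass m v) θ) (injOn_mul_sinh hM)
    (fun y : ℝ => (energy m (Fin.cons y v : Fin (k + 1) → ℝ))⁻¹ •
        u (onShell m (Fin.cons y v : Fin (k + 1) → ℝ)))
  rw [range_mul_sinh hM, setIntegral_univ, setIntegral_univ] at h
  rw [h]
  exact integral_congr_ae (Eventually.of_forall fun θ => abs_smul_energy_rapidity hm v u θ)

theorem integrable_rapidity (hm : 0 < m) (v : Fin k → ℝ) (u : Spacetime k → ℂ)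
    (hu : Integrable fun y : ℝ => (energy m (Fin.cons y v : Fin (k + 1) → ℝ))⁻¹ •
        u (onShell m (Fin.cons y v : Fin (k + 1) → ℝ))) :
    Integrable fun θ : ℝ => u (rapidityPoint m v θ) := by
  have hM := transverseMass_pos hm v
  have h := integrableOn_image_iff_integrableOn_abs_deriv_smul MeasurableSet.univ
    (fun θ _ => hasDerivWithinAt_mul_sinh (transverseMass m v) θ) (injOn_mul_sinh hM)
    (fun y : ℝ => (energy m (Fin.cons y v : Fin (k + 1) → ℝ))⁻¹ •
        u (onShell m (Fin.cons y v : Fin (k + 1) → ℝ)))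
  rw [range_mul_sinh hM, integrableOn_univ, integrableOn_univ] at h
  exact (h.1 hu).congr (Eventually.of_forall fun θ => abs_smul_energy_rapidity hm v u θ)

theorem measurePreserving_cons_real (k : ℕ) :
    MeasurePreserving (fun z : ℝ × (Fin k → ℝ) => (Fin.cons z.1 z.2 : Fin (k + 1) → ℝ))
      (volume.prod volume) volume := by
  have h := (volume_preserving_piFinSuccAbove (fun _ : Fin (k + 1) => ℝ) 0).symm
  have e : (fun z : ℝ × (Fin k → ℝ) => (Fin.cons z.1 z.2 : Fin (k + 1) → ℝ)) =
      (MeasurableEquiv.piFinSuccAbove (fun _ : Fin (k + 1) => ℝ) 0).symm :=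
    funext fun z => (Fin.insertNth_zero' z.1 z.2).symm
  rw [e]
  exact h

theorem measurable_energy_density (k : ℕ) (m : ℝ) :
    Measurable fun q : Fin (k + 1) → ℝ => ENNReal.ofReal (energy m q)⁻¹ :=
  (continuous_energy m).measurable.inv.ennreal_ofReal

theorem integrable_prod_shell (hm : 0 < m) {u : Spacetime k → ℂ}
    (hu : Integrable u (shellMeasure k m)) :
    Integrable (fun z : ℝ × (Fin k → ℝ) => (energy m (Fin.cons z.1 z.2 : Fin (k + 1) → ℝ))⁻¹ •
      u (onShell m (Fin.cons z.1 z.2 : Fin (k + 1) → ℝ))) (volume.prod volume) := by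
  have h1 := (integrable_map_measure hu.1 (continuous_onShell m).aemeasurable).1 hu
  rw [integrable_withDensity_iff_integrable_smul'
    (measurable_energy_density k m)
    (Eventually.of_forall fun _ => ENNReal.ofReal_lt_top)] at h1
  refine ((measurePreserving_cons_real k).integrable_comp_of_integrable h1).congr
    (Eventually.of_forall fun z => ?_)
  simp only [Function.comp_apply]
  rw [ENNReal.toReal_ofReal (inv_nonneg.2 (energy_pos hm _).le)]

theorem ae_integrable_rapidityPoint (hm : 0 < m) {u : Spacetime k → ℂ}
    (hu : Integrable u (shellMeasure k m)) :
    ∀ᵐ v : Fin k → ℝ, Integrable fun θ : ℝ => u (rapidityPoint m v θ) := by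
  filter_upwards [(integrable_prod_shell hm hu).prod_left_ae] with v hv
  exact integrable_rapidity hm v u hv

/-- Fubini with the transverse momentum outside, followed by the rapidity substitution in the first
spatial component for each fixed v. The contour will be moved in the inner integral only. -/
theorem integral_shell_eq_rapidity (hm : 0 < m) {u : Spacetime k → ℂ}
    (hu : Integrable u (shellMeasure k m)) :
    ∫ q, u q ∂(shellMeasure k m) = ∫ v : Fin k → ℝ, ∫ θ : ℝ, u (rapidityPoint m v θ) := by
  have h1 := (integrable_map_measure hu.1 (continuous_onShell m).aemeasurable).1 hu
  have h2 := integrable_prod_shell hm hu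
  rw [shellMeasure, integral_map (continuous_onShell m).aemeasurable hu.1,
    integral_withDensity_eq_integral_toReal_smul
      (measurable_energy_density k m)
      (Eventually.of_forall fun _ => ENNReal.ofReal_lt_top)]
  have hc : ∀ q : Fin (k + 1) → ℝ, (ENNReal.ofReal (energy m q)⁻¹).toReal = (energy m q)⁻¹ :=
    fun q => ENNReal.toReal_ofReal (inv_nonneg.2 (energy_pos hm q).le)
  simp only [hc]
  have h3 := (measurePreserving_cons_real k).map_eq
  rw [← h3, integral_map (measurePreserving_cons_real k).measurable.aemeasurable,
    integral_prod_symm _ h2]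
  · exact integral_congr_ae (Eventually.of_forall fun v => integral_rapidity hm v u)
  · rw [h3]
    rw [integrable_withDensity_iff_integrable_smul'
      (measurable_energy_density k m)
      (Eventually.of_forall fun _ => ENNReal.ofReal_lt_top)] at h1
    simp only [hc] at h1
    exact h1.1

theorem mink_rapidityPoint (m : ℝ) (v : Fin k → ℝ) (θ : ℝ) (x : Spacetime k) :
    mink (rapidityPoint m v θ) x = transverseMass m v * Real.cosh θ * x 0 -
      transverseMass m v * Real.sinh θ * x 1 - ∑ i : Fin k, v i * x i.succ.succ := by
  simp only [mink, rapidityPoint, Fin.cons_zero, Fin.cons_succ, Fin.sum_univ_succ (n := k),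
    Fin.succ_zero_eq_one]
  ring

theorem minkFourier_neg_rapidityPoint (f : 𝓢(Spacetime k, ℂ)) (m : ℝ) (v : Fin k → ℝ) (θ : ℝ) :
    minkFourier f (-rapidityPoint m v θ) = rapidityFourier f (transverseMass m v) v θ := by
  rw [minkFourier, rapidityFourier]
  refine integral_congr_ae (Eventually.of_forall fun x => ?_)
  simp only [mink_neg_left, mink_rapidityPoint, rapidityPhase]
  congr 2
  push_cast
  ring

/-- Adding iπ to the rapidity changes the sign of cosh and sinh but not of v. The complex momentum
becomes minus the shell point with transverse part -v, so the boundary values at Im z = π give f⁺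
where those at Im z = 0 give f⁻. -/
theorem minkFourier_rapidityPoint_neg (f : 𝓢(Spacetime k, ℂ)) (m : ℝ) (v : Fin k → ℝ) (θ : ℝ) :
    minkFourier f (rapidityPoint m (-v) θ) =
      rapidityFourier f (transverseMass m v) v (θ + Real.pi * Complex.I) := by
  rw [minkFourier, rapidityFourier]
  refine integral_congr_ae (Eventually.of_forall fun x => ?_)
  simp only [mink_rapidityPoint, rapidityPhase, transverseMass_neg, Complex.cosh_add,
    Complex.sinh_add, Complex.cosh_mul_I, Complex.sinh_mul_I, Complex.cos_pi, Complex.sin_pi,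
    Pi.neg_apply]
  congr 2
  push_cast
  simp only [neg_mul, Finset.sum_neg_distrib]
  ring

/-- The Schwartz function `x ↦ f(-x)`. -/
noncomputable def reflect (f : 𝓢(Spacetime k, ℂ)) : 𝓢(Spacetime k, ℂ) :=
  SchwartzMap.compCLMOfContinuousLinearEquiv ℂ (ContinuousLinearEquiv.neg ℝ) f

theorem reflect_apply (f : 𝓢(Spacetime k, ℂ)) (x : Spacetime k) : reflect f x = f (-x) := rfl

/-- Reflection carries a function supported in the left wedge to one supported in the right wedge,
so that `isStripAnalytic_rapidityFourier` also serves for g. -/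
theorem minkFourier_reflect (f : 𝓢(Spacetime k, ℂ)) (p : Spacetime k) :
    minkFourier (reflect f) p = minkFourier f (-p) := by
  rw [minkFourier, minkFourier, ← integral_neg_eq_self]
  refine integral_congr_ae (Eventually.of_forall fun x => ?_)
  simp only [reflect_apply, neg_neg, mink_neg_left]
  rw [mink_comm, mink_neg_left, mink_comm]

/-! ### Admissible matrices -/

/-- The proper Lorentz transformation which reverses `x⁰` and `x¹`. -/
def wedgeFlip (k : ℕ) : Matrix (Fin (k + 2)) (Fin (k + 2)) ℝ :=
  Matrix.diagonal (Fin.cons (-1) (Fin.cons (-1) fun _ => 1))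

theorem wedgeFlip_mulVec_zero (x : Spacetime k) : (wedgeFlip k *ᵥ x) 0 = -x 0 := by
  simp [wedgeFlip, Matrix.mulVec_diagonal]

theorem wedgeFlip_mulVec_one (x : Spacetime k) : (wedgeFlip k *ᵥ x) 1 = -x 1 := by
  rw [← Fin.succ_zero_eq_one, wedgeFlip, Matrix.mulVec_diagonal]
  simp

theorem wedgeFlip_mulVec_succ_succ (x : Spacetime k) (i : Fin k) :
    (wedgeFlip k *ᵥ x) i.succ.succ = x i.succ.succ := by
  simp [wedgeFlip, Matrix.mulVec_diagonal]

theorem det_wedgeFlip (k : ℕ) : (wedgeFlip k).det = 1 := by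
  simp [wedgeFlip, Fin.prod_univ_succ]

theorem wedgeFlip_mulVec_mulVec (x : Spacetime k) : wedgeFlip k *ᵥ (wedgeFlip k *ᵥ x) = x := by
  funext i
  refine Fin.cases ?_ (fun i => Fin.cases ?_ (fun i => ?_) i) i
  · rw [wedgeFlip_mulVec_zero, wedgeFlip_mulVec_zero, neg_neg]
  · rw [Fin.succ_zero_eq_one, wedgeFlip_mulVec_one, wedgeFlip_mulVec_one, neg_neg]
  · rw [wedgeFlip_mulVec_succ_succ, wedgeFlip_mulVec_succ_succ]

theorem isProperAntichronous_wedgeFlip (k : ℕ) : IsProperAntichronous (wedgeFlip k) := by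
  refine ⟨⟨fun x y => ?_, det_wedgeFlip k⟩, ?_⟩
  · simp only [mink, Fin.sum_univ_succ (n := k), Fin.succ_zero_eq_one, wedgeFlip_mulVec_zero,
      wedgeFlip_mulVec_one, wedgeFlip_mulVec_succ_succ, neg_mul_neg]
  · simp [wedgeFlip]

theorem image_wedgeFlip (k : ℕ) :
    (fun x => wedgeFlip k *ᵥ x) '' rightWedge k = leftWedge k := by
  have h : ∀ x : Spacetime k, wedgeFlip k *ᵥ x ∈ leftWedge k ↔ x ∈ rightWedge k := by
    intro x
    simp only [leftWedge, rightWedge, Set.mem_ofPred_eq, Pi.neg_apply, wedgeFlip_mulVec_zero,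
      wedgeFlip_mulVec_one, neg_neg]
  ext y
  constructor
  · rintro ⟨x, hx, rfl⟩
    exact (h x).2 hx
  · intro hy
    refine ⟨wedgeFlip k *ᵥ y, (h _).1 ?_, wedgeFlip_mulVec_mulVec y⟩
    rwa [wedgeFlip_mulVec_mulVec]

/-- `Q` commutes with `wedgeFlip`, which acts as -1 on the (x⁰, x¹) plane and as 1 on the transverse
directions. Entries between the two eigenspaces must therefore vanish. -/
theorem IsAdmissible.apply_succ_succ {Q : Matrix (Fin (k + 2)) (Fin (k + 2)) ℝ}
    (hQ : IsAdmissible Q) (i : Fin k) : Q i.succ.succ 0 = 0 ∧ Q i.succ.succ 1 = 0 := by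
  have h := hQ.down_left _ (isProperAntichronous_wedgeFlip k) (image_wedgeFlip k)
  have hu : IsUnit (wedgeFlip k).det := by simp [det_wedgeFlip]
  have h2 : wedgeFlip k * Q = Q * wedgeFlip k := by
    conv_rhs => rw [← h]
    rw [Matrix.mul_assoc (_ * _), Matrix.nonsing_inv_mul _ hu, Matrix.mul_one]
  have h3 : ∀ j, Q i.succ.succ j =
      Q i.succ.succ j * (Fin.cons (-1) (Fin.cons (-1) fun _ => 1) : Fin (k + 2) → ℝ) j := by
    intro j
    have := congrFun (congrFun h2 i.succ.succ) j
    simpa [wedgeFlip, Matrix.diagonal_mul, Matrix.mul_diagonal] using this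
  constructor
  · have := h3 0
    simp only [Fin.cons_zero] at this
    linarith
  · have := h3 (Fin.succ 0)
    simp only [Fin.cons_zero, Fin.cons_succ] at this
    rw [Fin.succ_zero_eq_one] at this
    linarith

theorem mink_single_zero (x : Spacetime k) : mink x (Pi.single 0 1) = x 0 := by
  simp [mink]

theorem mink_single_one (x : Spacetime k) : mink x (Pi.single 1 1) = -x 1 := by
  rw [mink, Fin.sum_univ_succ]
  simp [Fin.ext_iff]

theorem IsAdmissible.apply_zero_one {Q : Matrix (Fin (k + 2)) (Fin (k + 2)) ℝ}
    (hQ : IsAdmissible Q) : Q 0 0 = 0 ∧ Q 1 1 = 0 ∧ Q 1 0 = Q 0 1 := by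
  have h00 := hQ.antisymm (Pi.single 0 1) (Pi.single 0 1)
  have h11 := hQ.antisymm (Pi.single 1 1) (Pi.single 1 1)
  have h01 := hQ.antisymm (Pi.single 0 1) (Pi.single 1 1)
  rw [mink_comm (Pi.single 0 1), mink_single_zero] at h00
  rw [mink_comm (Pi.single 1 1), mink_single_one] at h11
  rw [mink_comm (Pi.single 0 1), mink_single_zero, mink_single_one] at h01
  simp only [Matrix.mulVec_single_one, Matrix.col_apply] at h00 h11 h01
  exact ⟨by linarith, by linarith, by linarith⟩

/-- On the (x⁰, x¹) plane `Q` exchanges the two components and multiplies by κ. The rest depends on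
v but not on θ; it is the constant c in `deformationPhase`. -/
theorem mulVec_rapidityPoint {Q : Matrix (Fin (k + 2)) (Fin (k + 2)) ℝ} (hQ : IsAdmissible Q)
    (v : Fin k → ℝ) (θ : ℝ) (p : Spacetime k) :
    mink (Q *ᵥ rapidityPoint m v θ) p =
      Q 0 1 * transverseMass m v * (Real.sinh θ * p 0 - Real.cosh θ * p 1) +
        mink (Q *ᵥ (Fin.cons 0 (Fin.cons 0 v) : Spacetime k)) p := by
  obtain ⟨h00, h11, h10⟩ := hQ.apply_zero_one
  have hv : ∀ i, (Q *ᵥ rapidityPoint m v θ) i = Q i 0 * (transverseMass m v * Real.cosh θ) +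
      Q i 1 * (transverseMass m v * Real.sinh θ) +
      (Q *ᵥ (Fin.cons 0 (Fin.cons 0 v) : Spacetime k)) i := by
    intro i
    simp only [Matrix.mulVec, dotProduct, rapidityPoint, Fin.sum_univ_succ, Fin.cons_zero,
      Fin.cons_succ, Fin.succ_zero_eq_one]
    ring
  have hi : ∀ i : Fin k, (Q *ᵥ rapidityPoint m v θ) i.succ.succ =
      (Q *ᵥ (Fin.cons 0 (Fin.cons 0 v) : Spacetime k)) i.succ.succ := by
    intro i
    rw [hv, (hQ.apply_succ_succ i).1, (hQ.apply_succ_succ i).2]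
    ring
  simp only [mink, Fin.sum_univ_succ (n := k), Fin.succ_zero_eq_one, hi]
  rw [hv, hv, h00, h11, h10]
  ring

theorem transverse_neg (Q : Matrix (Fin (k + 2)) (Fin (k + 2)) ℝ) (v : Fin k → ℝ)
    (p : Spacetime k) :
    mink (Q *ᵥ (Fin.cons 0 (Fin.cons 0 (-v)) : Spacetime k)) p =
      -mink (Q *ᵥ (Fin.cons 0 (Fin.cons 0 v) : Spacetime k)) p := by
  have : (Fin.cons 0 (Fin.cons 0 (-v)) : Spacetime k) =
      -(Fin.cons 0 (Fin.cons 0 v) : Spacetime k) := by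
    funext i
    refine Fin.cases ?_ (fun i => Fin.cases ?_ (fun i => ?_) i) i <;> simp
  rw [this, Matrix.mulVec_neg, mink_neg_left]

/-! ### The contractions agree for bounded analytic deformations -/

theorem integrable_minkFourier_mul (hm : 0 < m) (f g : 𝓢(Spacetime k, ℂ)) :
    Integrable (fun q => minkFourier f q * minkFourier g (-q)) (shellMeasure k m) := by
  have h1 := memLp_minkFourier hm f 1 (Or.inl rfl)
  have h2 := memLp_minkFourier hm g (-1) (Or.inr rfl)
  simp only [one_smul, neg_smul] at h1 h2
  exact MemLp.integrable_mul (p := 2) (q := 2) h1 h2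

theorem IsHalfPlaneAnalytic.continuous_ofReal {S : ℂ → ℂ} (hS : IsHalfPlaneAnalytic S) :
    Continuous fun a : ℝ => S a :=
  hS.continuousOn.comp_continuous Complex.continuous_ofReal fun a => by simp

theorem integrable_deformed (hm : 0 < m) (Q : Matrix (Fin (k + 2)) (Fin (k + 2)) ℝ)
    (f g : 𝓢(Spacetime k, ℂ)) {s : ℝ → ℂ} (hs : Continuous s) {C : ℝ} (hC : ∀ a, ‖s a‖ ≤ C)
    {n : ℕ} (p : Fin n → Spacetime k) :
    Integrable (fun q => minkFourier f q * minkFourier g (-q) *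
      ∏ j, s (mink (Q *ᵥ q) (p j))) (shellMeasure k m) := by
  refine (integrable_minkFourier_mul hm f g).mul_bdd (c := C ^ n) ?_
    (Eventually.of_forall fun q => ?_)
  · refine Continuous.aestronglyMeasurable (continuous_finsetProd _ fun j _ => hs.comp ?_)
    exact (continuous_mink_mulVec Q).comp (Continuous.prodMk_left (p j))
  · rw [norm_prod]
    refine (Finset.prod_le_prod (fun _ _ => norm_nonneg _) fun j _ => hC _).trans ?_
    simp

/-- The heart of the argument. For almost every transverse momentum v the two rapidity integrals are
those of a single strip-analytic function along Im z = 0 and Im z = π, the second one taken at -v.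
-/
theorem integral_shell_deformed_eq (hm : 0 < m) {Q : Matrix (Fin (k + 2)) (Fin (k + 2)) ℝ}
    (hQ : IsAdmissible Q) (hκ : 0 ≤ Q 0 1) (f g : 𝓢(Spacetime k, ℂ))
    (hf : ∀ x, x ∉ rightWedge k → f x = 0) (hg : ∀ x, x ∉ leftWedge k → g x = 0)
    {S : ℂ → ℂ} (hS : IsHalfPlaneAnalytic S) {n : ℕ} (p : Fin n → Spacetime k)
    (hp : ∀ j, |p j 1| < p j 0) :
    ∫ q, minkFourier g q * minkFourier f (-q) * ∏ j, S (mink (Q *ᵥ q) (p j) : ℝ)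
        ∂(shellMeasure k m) =
      ∫ q, minkFourier f q * minkFourier g (-q) * ∏ j, S (-mink (Q *ᵥ q) (p j) : ℝ)
        ∂(shellMeasure k m) := by
  obtain ⟨C, hC⟩ := hS.bounded
  have hL := integrable_deformed hm Q g f hS.continuous_ofReal (fun a => hC a (by simp)) p
  have hR := integrable_deformed hm Q f g (s := fun a => S (-a : ℝ))
    (hS.continuous_ofReal.comp continuous_neg) (fun a => hC (-a : ℝ) (by simp)) p
  rw [integral_shell_eq_rapidity hm hL, integral_shell_eq_rapidity hm hR]
  -- Replaces v by -v in the right-hand integral, since the shift by iπ leaves v fixed while q ↦ -q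
  -- does not.
  refine (integral_congr_ae ?_).trans (integral_neg_eq_self _ volume)
  have hneg := (Measure.measurePreserving_neg
    (volume : Measure (Fin k → ℝ))).quasiMeasurePreserving.ae (ae_integrable_rapidityPoint hm hR)
  filter_upwards [ae_integrable_rapidityPoint hm hL, hneg] with v hv0 hv1
  have hM := transverseMass_pos hm v
  set H : ℂ → ℂ := fun z => rapidityFourier (reflect g) (transverseMass m v) v z *
    rapidityFourier f (transverseMass m v) v z *
    ∏ j, S (deformationPhase (Q 0 1 * transverseMass m v) (p j)
      (mink (Q *ᵥ (Fin.cons 0 (Fin.cons 0 v) : Spacetime k)) (p j)) z) with hH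
  have hHs : IsStripAnalytic H := by
    refine ((isStripAnalytic_rapidityFourier hM.le v (reflect g) fun x hx => ?_).mul
      (isStripAnalytic_rapidityFourier hM.le v f hf)).mul
      (IsStripAnalytic.finset_prod _ fun j =>
        isStripAnalytic_comp_deformationPhase hS (mul_nonneg hκ hM.le) (hp j) _)
    rw [reflect_apply]
    exact hg _ (by simpa [leftWedge] using hx)
  have e0 : ∀ θ : ℝ, minkFourier g (rapidityPoint m v θ) *
      minkFourier f (-rapidityPoint m v θ) *
      ∏ j, S (mink (Q *ᵥ rapidityPoint m v θ) (p j) : ℝ) = H θ := by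
    intro θ
    simp only [hH]
    rw [← minkFourier_neg_rapidityPoint, ← minkFourier_neg_rapidityPoint, minkFourier_reflect,
      neg_neg]
    congr 1
    refine Finset.prod_congr rfl fun j _ => ?_
    rw [mulVec_rapidityPoint hQ, deformationPhase]
    push_cast
    rfl
  have e1 : ∀ θ : ℝ, minkFourier f (rapidityPoint m (-v) θ) *
      minkFourier g (-rapidityPoint m (-v) θ) *
      ∏ j, S (-mink (Q *ᵥ rapidityPoint m (-v) θ) (p j) : ℝ) =
      H (θ + Real.pi * Complex.I) := by
    intro θ
    simp only [hH]
    rw [← minkFourier_rapidityPoint_neg, ← minkFourier_rapidityPoint_neg, minkFourier_reflect,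
      mul_comm (minkFourier f _)]
    congr 1
    refine Finset.prod_congr rfl fun j _ => ?_
    rw [mulVec_rapidityPoint hQ, deformationPhase, transverse_neg, transverseMass_neg]
    -- The term with κ changes sign through the shift by iπ, the transverse term through v ↦ -v.
    congr 1
    simp only [Complex.cosh_add, Complex.sinh_add, Complex.cosh_mul_I, Complex.sinh_mul_I,
      Complex.cos_pi, Complex.sin_pi]
    push_cast
    ring
  have h0 : Integrable fun θ : ℝ => H θ := hv0.congr (Eventually.of_forall e0)
  have h1 : Integrable fun θ : ℝ => H (θ + Real.pi * Complex.I) :=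
    hv1.congr (Eventually.of_forall e1)
  have h := hHs.integral_eq h0 h1
  rw [← integral_congr_ae (Eventually.of_forall e0),
    ← integral_congr_ae (Eventually.of_forall e1)] at h
  exact h

/-! ### Approximation of deformation functions by bounded analytic functions -/

/-- A half-line Fourier integral is bounded and analytic on the upper half plane. -/
theorem isHalfPlaneAnalytic_integral {w : ℝ → ℂ} (hw : Integrable w)
    (hw' : Integrable fun t => t * w t) :
    IsHalfPlaneAnalytic fun z =>
      ∫ t in Set.Ioi (0 : ℝ), w t * Complex.exp (2 * Real.pi * Complex.I * z * t) := by
  have hmeas : ∀ z : ℂ, AEStronglyMeasurable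
      (fun t : ℝ => w t * Complex.exp (2 * Real.pi * Complex.I * z * t))
      (volume.restrict (Set.Ioi 0)) := fun z =>
    (hw.1.mul (by fun_prop : Continuous fun t : ℝ =>
      Complex.exp (2 * Real.pi * Complex.I * z * t)).aestronglyMeasurable).restrict
  have hexp : ∀ z : ℂ, 0 ≤ z.im → ∀ t ∈ Set.Ioi (0 : ℝ),
      ‖Complex.exp (2 * Real.pi * Complex.I * z * t)‖ ≤ 1 := by
    intro z hz t ht
    rw [Complex.norm_exp, Real.exp_le_one_iff]
    have : (2 * Real.pi * Complex.I * z * t).re = -(2 * Real.pi * z.im * t) := by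
      simp [Complex.mul_re, Complex.mul_im]
    rw [this, neg_nonpos]
    have := Real.pi_pos
    have ht' : 0 < t := ht
    positivity
  have hle : ∀ z : ℂ, 0 ≤ z.im → ∀ᵐ t ∂(volume.restrict (Set.Ioi (0 : ℝ))),
      ‖w t * Complex.exp (2 * Real.pi * Complex.I * z * t)‖ ≤ ‖w t‖ := by
    intro z hz
    filter_upwards [ae_restrict_mem measurableSet_Ioi] with t ht
    rw [norm_mul]
    exact mul_le_of_le_one_right (norm_nonneg _) (hexp z hz t ht)
  refine ⟨?_, ?_, ∫ t in Set.Ioi (0 : ℝ), ‖w t‖, ?_⟩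
  · refine continuousOn_of_dominated (bound := fun t => ‖w t‖) (fun z _ => hmeas z)
      (fun z hz => hle z hz) hw.norm.restrict (Eventually.of_forall fun t => ?_)
    exact (by fun_prop : Continuous fun z : ℂ =>
      w t * Complex.exp (2 * Real.pi * Complex.I * z * t)).continuousOn
  · intro z₀ hz₀
    have hs : {z : ℂ | 0 < z.im} ∈ 𝓝 z₀ :=
      (isOpen_lt continuous_const Complex.continuous_im).mem_nhds hz₀
    refine (hasDerivAt_integral_of_dominated_loc_of_deriv_le
      (μ := volume.restrict (Set.Ioi (0 : ℝ)))
      (F := fun z (t : ℝ) => w t * Complex.exp (2 * Real.pi * Complex.I * z * t))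
      (F' := fun z (t : ℝ) => w t * (Complex.exp (2 * Real.pi * Complex.I * z * t) *
        (2 * Real.pi * Complex.I * t)))
      (bound := fun t => 2 * Real.pi * ‖t * w t‖) hs
      (Eventually.of_forall hmeas) ?_ ?_ ?_ (hw'.norm.restrict.const_mul _)
      (Eventually.of_forall fun t z hz => ?_)).2.differentiableAt.differentiableWithinAt
    · exact hw.restrict.mono (hmeas z₀) (hle z₀ (le_of_lt hz₀))
    · exact (hw.1.mul (by fun_prop : Continuous fun t : ℝ =>
        Complex.exp (2 * Real.pi * Complex.I * z₀ * t) *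
          (2 * Real.pi * Complex.I * t)).aestronglyMeasurable).restrict
    · filter_upwards [ae_restrict_mem measurableSet_Ioi] with t ht z hz
      have h1 := hexp z (le_of_lt hz) t ht
      simp only [norm_mul, Complex.norm_I, Complex.norm_real, Complex.norm_two, mul_one,
        Real.norm_of_nonneg Real.pi_pos.le]
      have hpi := Real.pi_pos
      calc ‖w t‖ * (‖Complex.exp (2 * Real.pi * Complex.I * z * t)‖ * (2 * Real.pi * ‖t‖))
          ≤ ‖w t‖ * (1 * (2 * Real.pi * ‖t‖)) := by gcongr
        _ = 2 * Real.pi * (‖t‖ * ‖w t‖) := by ring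
    · have h : HasDerivAt (fun z : ℂ => 2 * Real.pi * Complex.I * z * t)
          (2 * Real.pi * Complex.I * t) z := by
        simpa using ((hasDerivAt_id z).const_mul (2 * Real.pi * Complex.I : ℂ)).mul_const (t : ℂ)
      exact h.cexp.const_mul _
  · intro z hz
    exact norm_integral_le_of_norm_le hw.norm.restrict (hle z hz)

/-- Gaussian summation of the inverse Fourier integral is convolution with a Gaussian. -/
theorem integral_gaussian_fourier {A : ℝ → ℂ} (hA : Integrable A) {c : ℝ} (hc : 0 < c) (x : ℝ) :
    ∫ t : ℝ, Complex.exp (-c⁻¹ * ‖t‖ ^ 2 + 2 * Real.pi * Complex.I * (inner ℝ x t : ℝ)) • 𝓕 A t =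
      ∫ w : ℝ, ((Real.pi * c : ℂ) ^ (Module.finrank ℝ ℝ / 2 : ℂ) *
        Complex.exp (-Real.pi ^ 2 * c * ‖x - w‖ ^ 2)) • A w := by
  have J : Integrable (fun w : ℝ =>
      Complex.exp (-c⁻¹ * ‖w‖ ^ 2 + 2 * Real.pi * Complex.I * (inner ℝ x w : ℝ))) :=
    GaussianFourier.integrable_cexp_neg_mul_sq_norm_add (by simpa) _ _
  have h := (VectorFourier.integral_fourierIntegral_smul_eq_flip (L := innerₗ ℝ)
      Real.continuous_fourierChar continuous_inner J hA).symm
  have h' : ∫ t : ℝ, Complex.exp (-c⁻¹ * ‖t‖ ^ 2 + 2 * Real.pi * Complex.I * (inner ℝ x t : ℝ)) •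
      𝓕 A t = ∫ w : ℝ, 𝓕 (fun w : ℝ => Complex.exp (-c⁻¹ * ‖w‖ ^ 2 +
        2 * Real.pi * Complex.I * (inner ℝ x w : ℝ))) w • A w := by
    simpa using! h
  rw [h']
  congr with w
  rw [fourier_gaussian_innerProductSpace' (by simpa)]
  congr
  · simp
  · simp; ring

/-- The Gaussian kernel of the convolution is nonnegative in modulus with total mass one, so it
preserves the bound 1 uniformly in c. -/
theorem norm_integral_gaussian_fourier_le {A : ℝ → ℂ} (hA : Integrable A)
    (hA1 : ∀ a, ‖A a‖ ≤ 1) {c : ℝ} (hc : 0 < c) (x : ℝ) :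
    ‖∫ t : ℝ, Complex.exp (-c⁻¹ * ‖t‖ ^ 2 + 2 * Real.pi * Complex.I * (inner ℝ x t : ℝ)) •
      𝓕 A t‖ ≤ 1 := by
  rw [integral_gaussian_fourier hA hc]
  have hpi := Real.pi_pos
  have hb : 0 < Real.pi ^ 2 * c := by positivity
  have hi : Integrable fun w : ℝ =>
      (Real.pi * c) ^ (1 / 2 : ℝ) * Real.exp (-(Real.pi ^ 2 * c) * (w - x) ^ 2) :=
    ((integrable_exp_neg_mul_sq hb).comp_sub_right x).const_mul _
  refine (norm_integral_le_of_norm_le hi (Eventually.of_forall fun w => ?_)).trans (le_of_eq ?_)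
  · rw [norm_smul, norm_mul]
    have h1 : ‖((Real.pi * c : ℂ) ^ (Module.finrank ℝ ℝ / 2 : ℂ))‖ =
        (Real.pi * c) ^ (1 / 2 : ℝ) := by
      rw [← Complex.ofReal_mul, Complex.norm_cpow_eq_rpow_re_of_pos (by positivity)]
      simp
    have h2 : ‖Complex.exp (-Real.pi ^ 2 * c * ‖x - w‖ ^ 2)‖ =
        Real.exp (-(Real.pi ^ 2 * c) * (w - x) ^ 2) := by
      have : (-Real.pi ^ 2 * c * ‖x - w‖ ^ 2 : ℂ) =
          ((-(Real.pi ^ 2 * c) * (w - x) ^ 2 : ℝ) : ℂ) := by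
        rw [← Complex.ofReal_pow ‖x - w‖, Real.norm_eq_abs, sq_abs]
        push_cast
        ring
      rw [this, Complex.norm_exp_ofReal]
    rw [h1, h2]
    exact mul_le_of_le_one_right (by positivity) (hA1 w)
  · rw [integral_const_mul, integral_sub_right_eq_self
      (fun w : ℝ => Real.exp (-(Real.pi ^ 2 * c) * w ^ 2)) x, integral_gaussian,
      ← Real.sqrt_eq_rpow, ← Real.sqrt_mul (by positivity), Real.sqrt_eq_one]
    field_simp

/-! ### Regularization of the deformation function -/

theorem exists_smooth_mollifier :
    ∃ v : ℝ → ℂ, ContDiff ℝ ((⊤ : ℕ∞) : WithTop ℕ∞) v ∧ HasCompactSupport v ∧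
      (∀ r, v r ≠ 0 → r ∈ Set.Icc (-2 : ℝ) (-1)) ∧ ∫ r, v r = 1 ∧ ∫ r, ‖v r‖ = 1 := by
  -- The support is to be bounded away from 0 on the negative side. Mass one will give 𝓕 v 0 = 1,
  -- and L¹ norm one gives ‖𝓕 v‖ ≤ 1.
  let b : ContDiffBump (-(3 / 2) : ℝ) := ⟨1 / 4, 1 / 2, by norm_num, by norm_num⟩
  refine ⟨fun r => (b.normed volume r : ℂ), ?_, ?_, ?_, ?_, ?_⟩
  · exact Complex.ofRealCLM.contDiff.comp b.contDiff_normed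
  · exact b.hasCompactSupport_normed.comp_left Complex.ofReal_zero
  · intro r hr
    have h : r ∈ Function.support (b.normed volume) := by
      intro h
      exact hr (by simp [h])
    rw [b.support_normed_eq, Metric.mem_ball, Real.dist_eq, abs_lt] at h
    have hb : b.rOut = 1 / 2 := rfl
    rw [hb] at h
    exact ⟨by linarith [h.1], by linarith [h.2]⟩
  · rw [integral_complex_ofReal, b.integral_normed, Complex.ofReal_one]
  · simp only [Complex.norm_real, Real.norm_of_nonneg (b.nonneg_normed _)]
    exact b.integral_normed

/-- The rescaled and translated function `s ↦ ε⁻¹ v(ε⁻¹(s - t))` as a test function. -/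
noncomputable def rescaled {v : ℝ → ℂ} (hv : ContDiff ℝ ((⊤ : ℕ∞) : WithTop ℕ∞) v)
    (hc : HasCompactSupport v) {ε : ℝ} (hε : 0 < ε) (t : ℝ) : 𝓢(ℝ, ℂ) :=
  HasCompactSupport.toSchwartzMap (f := fun s => (ε⁻¹ : ℂ) * v (ε⁻¹ * (s - t)))
    (((hc.comp_homeomorph ((Homeomorph.subRight t).trans
      (Homeomorph.mulLeft₀ ε⁻¹ (inv_ne_zero hε.ne'))))).mul_left)
    (contDiff_const.mul (hv.comp (contDiff_const.mul (contDiff_id.sub contDiff_const))))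

theorem rescaled_apply {v : ℝ → ℂ} (hv : ContDiff ℝ ((⊤ : ℕ∞) : WithTop ℕ∞) v)
    (hc : HasCompactSupport v) {ε : ℝ} (hε : 0 < ε) (t s : ℝ) :
    rescaled hv hc hε t s = (ε⁻¹ : ℂ) * v (ε⁻¹ * (s - t)) := rfl

theorem fourier_rescaled {v : ℝ → ℂ} (hv : ContDiff ℝ ((⊤ : ℕ∞) : WithTop ℕ∞) v)
    (hc : HasCompactSupport v) {ε : ℝ} (hε : 0 < ε) (t a : ℝ) :
    𝓕 (rescaled hv hc hε t) a =
      Complex.exp ((-2 * Real.pi * a * t : ℝ) * Complex.I) * 𝓕 v (ε * a) := by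
  rw [SchwartzMap.fourier_coe, Real.fourier_real_eq_integral_exp_smul,
    Real.fourier_real_eq_integral_exp_smul]
  simp only [rescaled_apply, smul_eq_mul]
  rw [← integral_add_right_eq_self _ t]
  simp only [add_sub_cancel_right]
  have h := Measure.integral_comp_mul_left (fun r : ℝ =>
    Complex.exp ((-2 * Real.pi * (ε * r + t) * a : ℝ) * Complex.I) * v r) ε⁻¹
  rw [inv_inv, abs_of_pos hε] at h
  have e : ∀ s : ℝ, Complex.exp ((-2 * Real.pi * (s + t) * a : ℝ) * Complex.I) *
      ((ε⁻¹ : ℂ) * v (ε⁻¹ * s)) = (ε⁻¹ : ℂ) * (Complex.exp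
        ((-2 * Real.pi * (ε * (ε⁻¹ * s) + t) * a : ℝ) * Complex.I) * v (ε⁻¹ * s)) := by
    intro s
    rw [mul_inv_cancel_left₀ hε.ne']
    ring
  simp only [e]
  rw [integral_const_mul, h, Complex.real_smul,
    inv_mul_cancel_left₀ (Complex.ofReal_ne_zero.2 hε.ne'), ← integral_const_mul]
  refine integral_congr_ae (Eventually.of_forall fun r => ?_)
  simp only
  rw [← mul_assoc, ← Complex.exp_add]
  congr 2
  push_cast
  ring

theorem DeformationFunction.integral_mul_fourier_eq_zero (R : DeformationFunction) {u : 𝓢(ℝ, ℂ)}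
    (hu : tsupport u ⊆ Set.Iio (0 : ℝ)) : ∫ a, 𝓕 u a * R a = 0 := by
  have h := R.fourier_support u hu
  rw [TemperedDistribution.fourier_apply, toDistribution, Lp.toTemperedDistribution_apply] at h
  rw [← h]
  refine integral_congr_ae ?_
  filter_upwards [(memLp_top_of_unimodular R.continuous R.unimodular).coeFn_toLp] with a ha
  rw [ha, smul_eq_mul]

/-- The Fourier transform of the regularized deformation function lives on the positive half
line. -/
theorem DeformationFunction.fourier_mul_eq_zero (R : DeformationFunction) {v : ℝ → ℂ}
    (hv : ContDiff ℝ ((⊤ : ℕ∞) : WithTop ℕ∞) v) (hc : HasCompactSupport v)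
    (hs : ∀ r, v r ≠ 0 → r ∈ Set.Icc (-2 : ℝ) (-1)) {ε : ℝ} (hε : 0 < ε) {t : ℝ} (ht : t ≤ 0) :
    𝓕 (fun a => R a * 𝓕 v (ε * a)) t = 0 := by
  -- The value at t of the Fourier transform is R̃ tested against `rescaled hv hc hε t`. As v lives
  -- on [-2, -1], this test function lives on s ≤ t - ε < 0, where R̃ vanishes; the gap ε covers the
  -- endpoint t = 0.
  have hu : tsupport (rescaled hv hc hε t) ⊆ Set.Iio (0 : ℝ) := by
    refine (closure_minimal (t := Set.Iic (t - ε)) ?_ isClosed_Iic).trans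
      (Set.Iic_subset_Iio.2 (by linarith))
    intro s hs'
    rw [Function.mem_support, rescaled_apply] at hs'
    have h1 := (hs _ (right_ne_zero_of_mul hs')).2
    rw [inv_mul_le_iff₀ hε] at h1
    rw [Set.mem_Iic]
    linarith
  rw [← R.integral_mul_fourier_eq_zero hu, Real.fourier_real_eq_integral_exp_smul]
  refine integral_congr_ae (Eventually.of_forall fun a => ?_)
  simp only [fourier_rescaled, smul_eq_mul]
  ring

theorem norm_fourier_mollifier_le {v : ℝ → ℂ} (h1 : ∫ r, ‖v r‖ = 1) (a : ℝ) : ‖𝓕 v a‖ ≤ 1 :=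
  (VectorFourier.norm_fourierIntegral_le_integral_norm _ _ _ _ _).trans h1.le

/-- Bounded analytic functions approximating a deformation function multiplied by `h(εa)`. -/
theorem DeformationFunction.exists_gaussian_approximation (R : DeformationFunction) {v : ℝ → ℂ}
    (hv : ContDiff ℝ ((⊤ : ℕ∞) : WithTop ℕ∞) v) (hc : HasCompactSupport v)
    (hs : ∀ r, v r ≠ 0 → r ∈ Set.Icc (-2 : ℝ) (-1)) (h1 : ∫ r, ‖v r‖ = 1)
    {ε : ℝ} (hε : 0 < ε) :
    ∃ F : ℝ → ℂ → ℂ, (∀ c > 0, IsHalfPlaneAnalytic (F c)) ∧ (∀ c > 0, ∀ a : ℝ, ‖F c a‖ ≤ 1) ∧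
      ∀ a : ℝ, Tendsto (fun c => F c a) atTop (𝓝 (R a * 𝓕 v (ε * a))) := by
  set A : ℝ → ℂ := fun a => R a * 𝓕 v (ε * a) with hA
  set V : 𝓢(ℝ, ℂ) := 𝓕 (hc.toSchwartzMap hv) with hV
  have hVv : ∀ a, V a = 𝓕 v a := fun a => by
    rw [hV, SchwartzMap.fourier_coe]
    rfl
  have hAc : Continuous A := by
    have h2 : A = fun a => R a * V (ε * a) := funext fun a => by rw [hVv]
    rw [h2]
    exact R.continuous.mul (V.continuous.comp (continuous_const.mul continuous_id))
  have hAi : Integrable A := by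
    have h2 : Integrable fun a => V (ε * a) := V.integrable.comp_mul_left' hε.ne'
    refine (h2.bdd_mul (c := 1) R.continuous.aestronglyMeasurable
      (Eventually.of_forall fun a => (R.norm_eq_one a).le)).congr
      (Eventually.of_forall fun a => ?_)
    simp only [hVv, hA]
  have hA1 : ∀ a, ‖A a‖ ≤ 1 := fun a => by
    rw [hA, norm_mul, R.norm_eq_one, one_mul]
    exact norm_fourier_mollifier_le h1 _
  have hFc : Continuous (𝓕 A) :=
    VectorFourier.fourierIntegral_continuous Real.continuous_fourierChar
      (by exact continuous_inner) hAi
  have hFb : ∀ t, ‖𝓕 A t‖ ≤ ∫ a, ‖A a‖ := fun t =>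
    VectorFourier.norm_fourierIntegral_le_integral_norm _ _ _ _ _
  -- Because 𝓕 A vanishes for t ≤ 0, the half-line integral, which continues analytically to Im z >
  -- 0, agrees on the real axis with the full Gaussian-regularized inverse Fourier integral.
  have hreal : ∀ (c : ℝ) (a : ℝ), ∫ t in Set.Ioi (0 : ℝ), (Complex.exp (-c⁻¹ * t ^ 2) * 𝓕 A t) *
      Complex.exp (2 * Real.pi * Complex.I * a * t) =
      ∫ t : ℝ, Complex.exp (-c⁻¹ * ‖t‖ ^ 2 + 2 * Real.pi * Complex.I * (inner ℝ a t : ℝ)) •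
        𝓕 A t := by
    intro c a
    rw [setIntegral_eq_integral_of_forall_compl_eq_zero]
    · refine integral_congr_ae (Eventually.of_forall fun t => ?_)
      simp only [smul_eq_mul, Complex.exp_add, ← Complex.ofReal_pow, Real.norm_eq_abs, sq_abs]
      simp only [Real.inner_apply]
      push_cast
      ring_nf
    · intro t ht
      rw [hA, R.fourier_mul_eq_zero hv hc hs hε (not_lt.1 ht), mul_zero, zero_mul]
  refine ⟨fun c z => ∫ t in Set.Ioi (0 : ℝ), (Complex.exp (-c⁻¹ * t ^ 2) * 𝓕 A t) *
      Complex.exp (2 * Real.pi * Complex.I * z * t), fun c hc0 => ?_, fun c hc0 a => ?_,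
      fun a => ?_⟩
  -- 𝓕 A is only known to be bounded and continuous; the Gaussian factor supplies the integrability,
  -- also after multiplication by t.
  · have hb : 0 < ((c⁻¹ : ℝ) : ℂ).re := by simpa using hc0
    have hi : Integrable fun t : ℝ => Complex.exp (-c⁻¹ * t ^ 2) := by
      simpa using integrable_cexp_neg_mul_sq hb
    have hi' : Integrable fun t : ℝ => (t : ℂ) * Complex.exp (-c⁻¹ * t ^ 2) := by
      simpa using integrable_mul_cexp_neg_mul_sq hb
    refine isHalfPlaneAnalytic_integral ?_ ?_
    · exact hi.mul_bdd hFc.aestronglyMeasurable (Eventually.of_forall hFb)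
    · refine (hi'.mul_bdd hFc.aestronglyMeasurable
        (Eventually.of_forall hFb)).congr (Eventually.of_forall fun t => ?_)
      exact mul_assoc _ _ _
  · simp only
    rw [hreal]
    exact norm_integral_gaussian_fourier_le hAi hA1 hc0 a
  · refine (Real.tendsto_integral_gaussian_smul' hAi hAc.continuousAt).congr' ?_
    filter_upwards [eventually_gt_atTop 0] with c hc0
    rw [hreal, integral_gaussian_fourier hAi hc0]

/-! ### The contractions agree -/

/-- Equality of the two contraction integrals for a function `r` in place of a deformation
function. -/
def ContractionsAgree (m : ℝ) (Q : Matrix (Fin (k + 2)) (Fin (k + 2)) ℝ)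
    (f g : 𝓢(Spacetime k, ℂ)) {n : ℕ} (p : Fin n → Spacetime k) (r : ℝ → ℂ) : Prop :=
  ∫ q, minkFourier g q * minkFourier f (-q) *
      ∏ j, (r (mink (Q *ᵥ q) (p j)) * conj (r (-mink (Q *ᵥ q) (p j)))) ∂(shellMeasure k m) =
    ∫ q, minkFourier f q * minkFourier g (-q) *
      ∏ j, (r (-mink (Q *ᵥ q) (p j)) * conj (r (mink (Q *ᵥ q) (p j)))) ∂(shellMeasure k m)

theorem contractionsAgree_of_isHalfPlaneAnalytic (hm : 0 < m)
    {Q : Matrix (Fin (k + 2)) (Fin (k + 2)) ℝ}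
    (hQ : IsAdmissible Q) (hκ : 0 ≤ Q 0 1) (f g : 𝓢(Spacetime k, ℂ))
    (hf : ∀ x, x ∉ rightWedge k → f x = 0) (hg : ∀ x, x ∉ leftWedge k → g x = 0)
    {n : ℕ} (p : Fin n → Spacetime k) (hp : ∀ j, |p j 1| < p j 0)
    {F : ℂ → ℂ} (hF : IsHalfPlaneAnalytic F) :
    ContractionsAgree m Q f g p fun a => F a := by
  -- The half-plane function used is z ↦ F(z) conj F(-conj z), whose boundary values are F(a) conj
  -- F(-a).
  have h := integral_shell_deformed_eq hm hQ hκ f g hf hg (hF.mul hF.conj_neg_conj) p hp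
  simpa only [ContractionsAgree, Complex.conj_ofReal, Complex.ofReal_neg, map_neg, neg_neg] using h

theorem tendsto_integral_deformed (hm : 0 < m) (Q : Matrix (Fin (k + 2)) (Fin (k + 2)) ℝ)
    (f g : 𝓢(Spacetime k, ℂ)) {n : ℕ} (p : Fin n → Spacetime k) {l : Filter ℝ}
    [l.IsCountablyGenerated] {s : ℝ → ℝ → ℂ} {s₀ : ℝ → ℂ}
    (hc : ∀ᶠ c in l, Continuous (s c)) (hb : ∀ᶠ c in l, ∀ a, ‖s c a‖ ≤ 1)
    (ht : ∀ a, Tendsto (fun c => s c a) l (𝓝 (s₀ a))) :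
    Tendsto (fun c => ∫ q, minkFourier f q * minkFourier g (-q) *
        ∏ j, s c (mink (Q *ᵥ q) (p j)) ∂(shellMeasure k m)) l
      (𝓝 (∫ q, minkFourier f q * minkFourier g (-q) *
        ∏ j, s₀ (mink (Q *ᵥ q) (p j)) ∂(shellMeasure k m))) := by
  refine tendsto_integral_filter_of_dominated_convergence
    (fun q => ‖minkFourier f q * minkFourier g (-q)‖) ?_ ?_
    (integrable_minkFourier_mul hm f g).norm (Eventually.of_forall fun q => ?_)
  · filter_upwards [hc, hb] with c h1 h2
    exact (integrable_deformed hm Q f g h1 h2 p).1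
  · filter_upwards [hb] with c h2
    refine Eventually.of_forall fun q => ?_
    rw [norm_mul]
    refine mul_le_of_le_one_right (norm_nonneg _) ?_
    rw [norm_prod]
    exact Finset.prod_le_one (fun _ _ => norm_nonneg _) fun j _ => h2 _
  · exact (tendsto_finsetProd _ fun j _ => ht _).const_mul _

/-- Only pointwise convergence on the real line and the uniform bound 1 are needed: the products of
Fourier transforms are integrable and dominate both integrands. -/
theorem ContractionsAgree.of_tendsto (hm : 0 < m) {Q : Matrix (Fin (k + 2)) (Fin (k + 2)) ℝ}
    {f g : 𝓢(Spacetime k, ℂ)} {n : ℕ} {p : Fin n → Spacetime k} {l : Filter ℝ} [l.NeBot]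
    [l.IsCountablyGenerated] {r : ℝ → ℝ → ℂ} {r₀ : ℝ → ℂ}
    (hc : ∀ᶠ c in l, Continuous (r c)) (hb : ∀ᶠ c in l, ∀ a, ‖r c a‖ ≤ 1)
    (ht : ∀ a, Tendsto (fun c => r c a) l (𝓝 (r₀ a)))
    (h : ∀ᶠ c in l, ContractionsAgree m Q f g p (r c)) : ContractionsAgree m Q f g p r₀ := by
  have hconj : ∀ a, Tendsto (fun c => conj (r c a)) l (𝓝 (conj (r₀ a))) := fun a =>
    (Complex.continuous_conj.tendsto _).comp (ht a)
  have hb' : ∀ᶠ c in l, ∀ a b, ‖r c a * conj (r c b)‖ ≤ 1 := by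
    filter_upwards [hb] with c h1 a b
    rw [norm_mul, RCLike.norm_conj]
    exact mul_le_one₀ (h1 a) (norm_nonneg _) (h1 b)
  have h1 := tendsto_integral_deformed hm Q g f p (l := l)
    (s := fun c a => r c a * conj (r c (-a))) (s₀ := fun a => r₀ a * conj (r₀ (-a)))
    (hc.mono fun c hcc => hcc.mul (Complex.continuous_conj.comp (hcc.comp continuous_neg)))
    (hb'.mono fun c h a => h a (-a)) fun a => (ht a).mul (hconj (-a))
  have h2 := tendsto_integral_deformed hm Q f g p (l := l)
    (s := fun c a => r c (-a) * conj (r c a)) (s₀ := fun a => r₀ (-a) * conj (r₀ a))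
    (hc.mono fun c hcc => (hcc.comp continuous_neg).mul (Complex.continuous_conj.comp hcc))
    (hb'.mono fun c h a => h (-a) a) fun a => (ht (-a)).mul (hconj a)
  exact tendsto_nhds_unique h1 (h2.congr' (h.mono fun c hcc => hcc.symm))

/-- Two limits: c → ∞ at fixed ε removes the Gaussian factor, then ε ↓ 0 removes the mollifier
because 𝓕 v (εa) tends to 𝓕 v 0 = 1. -/
theorem contractionsAgree (hm : 0 < m) (R : DeformationFunction)
    {Q : Matrix (Fin (k + 2)) (Fin (k + 2)) ℝ}
    (hQ : IsAdmissible Q) (hκ : 0 ≤ Q 0 1) (f g : 𝓢(Spacetime k, ℂ))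
    (hf : ∀ x, x ∉ rightWedge k → f x = 0) (hg : ∀ x, x ∉ leftWedge k → g x = 0)
    {n : ℕ} (p : Fin n → Spacetime k) (hp : ∀ j, |p j 1| < p j 0) :
    ContractionsAgree m Q f g p R := by
  obtain ⟨v, hv, hc, hs, h0, h1⟩ := exists_smooth_mollifier
  have hvc : Continuous (𝓕 v) := by
    have h2 : 𝓕 v = (𝓕 (hc.toSchwartzMap hv) : 𝓢(ℝ, ℂ)) := by
      rw [SchwartzMap.fourier_coe]
      rfl
    rw [h2]
    exact SchwartzMap.continuous _
  have hv0 : 𝓕 v 0 = 1 := by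
    rw [Real.fourier_real_eq_integral_exp_smul]
    simpa using h0
  refine ContractionsAgree.of_tendsto hm (l := 𝓝[>] (0 : ℝ))
    (r := fun ε a => R a * 𝓕 v (ε * a)) ?_ ?_ (fun a => ?_) ?_
  · exact Eventually.of_forall fun ε =>
      R.continuous.mul (hvc.comp (continuous_const.mul continuous_id))
  · refine Eventually.of_forall fun ε a => ?_
    rw [norm_mul, R.norm_eq_one, one_mul]
    exact norm_fourier_mollifier_le h1 _
  · have hcont : Continuous fun ε : ℝ => R a * 𝓕 v (ε * a) :=
      continuous_const.mul (hvc.comp (continuous_id.mul continuous_const))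
    have := (hcont.tendsto 0).mono_left (nhdsWithin_le_nhds (s := Set.Ioi 0))
    simpa [hv0] using this
  · filter_upwards [self_mem_nhdsWithin] with ε hε
    obtain ⟨F, hF, hF1, hFt⟩ := R.exists_gaussian_approximation hv hc hs h1 hε
    refine ContractionsAgree.of_tendsto hm (l := atTop) (r := fun c a => F c a) ?_ ?_ hFt ?_
    · filter_upwards [eventually_gt_atTop 0] with c hc0
      exact (hF c hc0).continuous_ofReal
    · filter_upwards [eventually_gt_atTop 0] with c hc0
      exact hF1 c hc0
    · filter_upwards [eventually_gt_atTop 0] with c hc0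
      exact contractionsAgree_of_isHalfPlaneAnalytic hm hQ hκ f g hf hg p hp (hF c hc0)

/-- The strict inequality uses m > 0; it is the condition that keeps the deformation phases in the
upper half plane. -/
theorem ae_shell_forward (hm : 0 < m) : ∀ᵐ q ∂(shellMeasure k m), |q 1| < q 0 := by
  have hms : MeasurableSet {q : Spacetime k | |q 1| < q 0} :=
    measurableSet_lt (measurable_pi_apply 1).abs (measurable_pi_apply 0)
  rw [shellMeasure, ae_map_iff (continuous_onShell m).aemeasurable hms]
  refine Eventually.of_forall fun q => ?_
  rw [← Fin.succ_zero_eq_one]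
  simp only [onShell, Fin.cons_zero, Fin.cons_succ]
  refine Real.lt_sqrt_of_sq_lt ?_
  rw [sq_abs]
  have h1 : q 0 ^ 2 ≤ ∑ i, q i ^ 2 :=
    Finset.single_le_sum (f := fun i => q i ^ 2) (fun i _ => sq_nonneg _) (Finset.mem_univ 0)
  have h2 : 0 < m ^ 2 := by positivity
  linarith

theorem ae_shellN_forward (hm : 0 < m) (n : ℕ) :
    ∀ᵐ p ∂(shellMeasureN k m n), ∀ j, |p j 1| < p j 0 :=
  ae_all_iff.2 fun j =>
    (Measure.quasiMeasurePreserving_eval (fun _ : Fin n => shellMeasure k m) j).ae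
      (ae_shell_forward hm)

theorem multiplier_mul_conj (R R' : DeformationFunction) (x y : Spacetime k) {n : ℕ}
    (p : Fin n → Spacetime k) : multiplier R x p * conj (multiplier R' y p) =
      ∏ j, (R (mink x (p j)) * conj (R' (mink y (p j)))) := by
  simp only [multiplier, map_prod, Finset.prod_mul_distrib]

/-- In each contraction exactly one of the two phases per momentum carries `-R`, so both sides have
the same factor (-1)ⁿ and the identity for `R` applies. -/
theorem contraction_opposite_eq (hm : 0 < m) (R : DeformationFunction)
    {Q : Matrix (Fin (k + 2)) (Fin (k + 2)) ℝ}
    (hQ : IsAdmissible Q) (hκ : 0 ≤ Q 0 1) (f g : 𝓢(Spacetime k, ℂ))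
    (hf : ∀ x, x ∉ rightWedge k → f x = 0) (hg : ∀ x, x ∉ leftWedge k → g x = 0)
    {n : ℕ} (p : Fin n → Spacetime k) (hp : ∀ j, |p j 1| < p j 0) :
    contraction m R (-R) Q (-Q) (conjMinusVector hm f) (plusVector hm g) p =
      contraction m (-R) R (-Q) Q (conjMinusVector hm g) (plusVector hm f) p := by
  have hplus : ∀ f : 𝓢(Spacetime k, ℂ),
      (plusVector hm f : Spacetime k → ℂ) =ᵐ[shellMeasure k m] fun q => minkFourier f q :=
    fun f => MemLp.coeFn_toLp _
  have hminus : ∀ f : 𝓢(Spacetime k, ℂ), (conjMinusVector hm f : Spacetime k → ℂ)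
      =ᵐ[shellMeasure k m] fun q => conj (minkFourier f (-q)) := fun f => MemLp.coeFn_toLp _
  have hneg : ∀ a, (-R : DeformationFunction) a = -R a := fun _ => rfl
  have h := contractionsAgree hm R hQ hκ f g hf hg p hp
  have hL : contraction m R (-R) Q (-Q) (conjMinusVector hm f) (plusVector hm g) p =
      (-1) ^ n * ∫ q, minkFourier g q * minkFourier f (-q) *
        ∏ j, (R (mink (Q *ᵥ q) (p j)) * conj (R (-mink (Q *ᵥ q) (p j))))
        ∂(shellMeasure k m) := by
    rw [contraction, ← integral_const_mul]
    refine integral_congr_ae ?_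
    filter_upwards [hplus g, hminus f] with q h1 h2
    rw [h1, h2, multiplier_mul_conj, Complex.conj_conj]
    simp only [Matrix.neg_mulVec, mink_neg_left, hneg, map_neg, mul_neg, Finset.prod_neg,
      Finset.card_univ, Fintype.card_fin]
    ring
  have hR : contraction m (-R) R (-Q) Q (conjMinusVector hm g) (plusVector hm f) p =
      (-1) ^ n * ∫ q, minkFourier f q * minkFourier g (-q) *
        ∏ j, (R (-mink (Q *ᵥ q) (p j)) * conj (R (mink (Q *ᵥ q) (p j))))
        ∂(shellMeasure k m) := by
    rw [contraction, ← integral_const_mul]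
    refine integral_congr_ae ?_
    filter_upwards [hplus f, hminus g] with q h1 h2
    rw [h1, h2, multiplier_mul_conj, Complex.conj_conj]
    simp only [Matrix.neg_mulVec, mink_neg_left, hneg, neg_mul, Finset.prod_neg,
      Finset.card_univ, Fintype.card_fin]
    ring
  rw [hL, hR]
  exact congrArg _ h

end DeformedFermion

/-! ### Vanishing of the commutator -/

theorem mainTheorem2 {k : ℕ} {m : ℝ} (hm : 0 < m)
    (R : DeformedFermion.DeformationFunction)
    (Q : Matrix (Fin (k + 2)) (Fin (k + 2)) ℝ) (hQ : DeformedFermion.IsAdmissible Q)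
    (hκ : 0 ≤ Q 0 1)
    (f g : SchwartzMap (DeformedFermion.Spacetime k) ℂ)
    (hf : tsupport f ⊆ DeformedFermion.rightWedge k)
    (hg : tsupport g ⊆ DeformedFermion.leftWedge k)
    (Ψ : DeformedFermion.finiteParticle k m) :
    DeformedFermion.field hm R Q f (DeformedFermion.field hm (-R) (-Q) g Ψ) -
      DeformedFermion.field hm (-R) (-Q) g (DeformedFermion.field hm R Q f Ψ) = 0 := by
  refine sub_eq_zero.2 (DeformedFermion.field_comm_of_contraction_eq hm
    (DeformedFermion.oppositeDeformation_neg R hQ.antisymm) f g (fun n => ?_) Ψ)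
  filter_upwards [DeformedFermion.ae_shellN_forward hm n] with p hp
  exact DeformedFermion.contraction_opposite_eq hm R hQ hκ f g
    (fun x hx => image_eq_zero_of_notMem_tsupport fun h => hx (hf h))
    (fun x hx => image_eq_zero_of_notMem_tsupport fun h => hx (hg h)) p hp
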